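/- Let $d\ge 1$ and let $\Omega\subset\mathbb{R}^d$ be a bounded open set with boundary $\partial\Omega$. For $\theta\in\mathbb{S}^{d-1}$ let $H_\theta=\theta^\perp$, let $\mathcal P_\theta$ be the orthogonal projection onto $H_\theta$, and for $y\in H_\theta$ let $\omega_\theta(y)=\{s\in\mathbb{R}: s\theta+y\in\Omega\}$. For $x\in\Omega$ let $\delta_\theta(x)=\sup\{s\ge 0:\ x+t\theta\in\Omega\ \text{for all } t\in[0,s)\}$ and $\Phi_\theta(x)=x+\delta_\theta(x)\theta\in\partial\Omega$. Let $\mu_\theta$ be the Borel measure on $\partial\Omega$ given by $\mu_\theta(A)=\int_\Omega \chi_A(\Phi_\theta(x))\,dx$. A function $g:\partial\Omega\to\mathbb{R}$ is a directional trace of $u\in H^1(\Omega)$ in the direction $\theta$ if, for some representative of $u$ and for $\lambda^{d-1}$-almost every $y\in\mathcal P_\theta(\Omega)$, the function $s\mapsto u(s\theta+y)$ belongs to $H^1(\omega_\theta(y))$ and, for every connected component $(\alpha,\beta)$ of $\omega_\theta(y)$, $g(\beta\theta+y)$ is the value at $\beta$ of its continuous representative on $(\alpha,\beta]$. Let $L^2(\partial\Omega,(\mu_\theta)_\theta)$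 be the set of functions $g$ on $\partial\Omega$ that belong, up to modification on a $\mu_\theta$-negligible set, to $\mathcal L^2(\partial\Omega,\mu_\theta)$ for every $\theta\in\mathbb{S}^{d-1}$, with $\sup_\theta\int_{\partial\Omega} g^2\,d\mu_\theta<\infty$, two functions being identified if they are equal $\mu_\theta$-a.e. for every $\theta$; its norm is $\|g\|=\sup_{\theta}\|g\|_{L^2(\partial\Omega,\mu_\theta)}$. A function $u\in H^1(\Omega)$ has the omnidirectional trace $g=\mathrm{tr}(u)\in L^2(\partial\Omega,(\mu_\theta)_\theta)$ if for every $\theta\in\mathbb{S}^{d-1}$ the function $g$ is $\mu_\theta$-a.e. equal to a directional trace of $u$ in the direction $\theta$. Let $H^1_{\rm tr}(\Omega)$ be the set of $u\in H^1(\Omega)$ that have an omnidirectional trace, and $H^1_{\rm tr,0}(\Omega)=\{u\in H^1_{\rm tr}(\Omega):\mathrm{tr}(u)=0\}$. Let $H^1_0(\Omega)$ and $\widetilde H^1(\Omega)$ be the closures in $H^1(\Omega)$ of $C^\infty_c(\Omega)$ and of $H^1(\Omega)\cap C^0(\overline\Omega)$ respectively. Then $$H^1_0(\Omega)\subset H^1_{\rm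 tr,0}(\Omega)\subset \widetilde H^1(\Omega)\subset H^1_{\rm tr}(\Omega).$$ In particular, every $u\in\widetilde H^1(\Omega)$ has an omnidirectional trace, which is unique as an element of $L^2(\partial\Omega,(\mu_\theta)_\theta)$; and for every sequence $(u_n)$ in $H^1(\Omega)\cap C^0(\overline\Omega)$ that converges to $u$ in $H^1(\Omega)$, the restrictions $u_n|_{\partial\Omega}$ converge in $L^2(\partial\Omega,(\mu_\theta)_\theta)$ to $\mathrm{tr}(u)$, which is their only limit there. -/

import Mathlib

open MeasureTheory Set Filter Topology
open scoped ENNReal ContDiff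

noncomputable section

namespace OmniTrace

/-- The Euclidean space of dimension `d`. -/
abbrev Euc (d : ℕ) : Type := EuclideanSpace ℝ (Fin d)

/-! ### Test functions and weak directional derivatives -/

section Weak

variable {E : Type*} [NormedAddCommGroup E] [NormedSpace ℝ E]

/-- `φ ∈ C^∞_c(Ω)`: `φ` is smooth, with compact support contained in `Ω`. -/
structure IsTestFunction (Ω : Set E) (φ : E → ℝ) : Prop where
  smooth : ContDiff ℝ ∞ φ
  compact : HasCompactSupport φ
  supp : tsupport φ ⊆ Ω

/-- `w` is the derivative of `u` along `v` in the weak sense on `Ω`: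
`∫_Ω u ∂_v φ = - ∫_Ω w φ` for all `φ ∈ C^∞_c(Ω)`. -/
def IsWeakDirDeriv [MeasureSpace E] (Ω : Set E) (v : E) (u w : E → ℝ) : Prop :=
  ∀ φ : E → ℝ, IsTestFunction Ω φ →
    ∫ x in Ω, u x * fderiv ℝ φ x v = - ∫ x in Ω, w x * φ x

/-- `u ∈ W_v(Ω)`: `u ∈ L²(Ω)` and its weak derivative along `v` is in `L²(Ω)`.
For an open subset `ω` of `ℝ` and `v = 1` this is membership in `H¹(ω)`. -/
def MemW [MeasureSpace E] (Ω : Set E) (v : E) (u : E → ℝ) : Prop :=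
  MemLp u 2 (volume.restrict Ω) ∧
    ∃ w : E → ℝ, MemLp w 2 (volume.restrict Ω) ∧ IsWeakDirDeriv Ω v u w

end Weak

variable {d : ℕ}

/-! ### The Sobolev space `H¹(Ω)` -/

/-- `G` is the gradient of `u` on `Ω` in the sense of distributions. -/
def IsWeakGradient (Ω : Set (Euc d)) (u : Euc d → ℝ) (G : Euc d → Euc d) : Prop :=
  ∀ v : Euc d, IsWeakDirDeriv Ω v u (fun x => inner ℝ (G x) v)

theorem IsTestFunction.memLp {Ω : Set (Euc d)} {φ : Euc d → ℝ} (h : IsTestFunction Ω φ) :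
    MemLp φ 2 (volume.restrict Ω) :=
  (h.smooth.continuous.memLp_of_hasCompactSupport h.compact).restrict Ω

theorem IsTestFunction.memLp_fderiv {Ω : Set (Euc d)} {φ : Euc d → ℝ}
    (h : IsTestFunction Ω φ) (v : Euc d) :
    MemLp (fun x => fderiv ℝ φ x v) 2 (volume.restrict Ω) := by
  have hc : Continuous (fun x => fderiv ℝ φ x v) :=
    (h.smooth.continuous_fderiv (by simp)).clm_apply continuous_const
  exact (hc.memLp_of_hasCompactSupport (h.compact.fderiv_apply ℝ v)).restrict Ω

/-- The Sobolev space `H¹(Ω)`. An element is a class `u ∈ L²(Ω)` together with its (unique) weak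
gradient `∇u ∈ L²(Ω)^d`; the norm inherited from the ambient space is
`‖u‖_{H¹(Ω)} = (‖u‖²_{L²(Ω)} + ‖∇u‖²_{L²(Ω)})^{1/2}`. -/
def H1 (Ω : Set (Euc d)) :
    Submodule ℝ (WithLp 2 (Lp ℝ 2 (volume.restrict Ω) × Lp (Euc d) 2 (volume.restrict Ω))) where
  carrier := {p | IsWeakGradient Ω p.fst p.snd}
  zero_mem' := by
    intro v φ hφ
    have h1 : ∀ᵐ x ∂(volume.restrict Ω), ((0 : Lp ℝ 2 (volume.restrict Ω)) : Euc d → ℝ) x = 0 :=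
      Lp.coeFn_zero ℝ 2 _
    have h2 : ∀ᵐ x ∂(volume.restrict Ω),
        ((0 : Lp (Euc d) 2 (volume.restrict Ω)) : Euc d → Euc d) x = 0 :=
      Lp.coeFn_zero (Euc d) 2 _
    have e1 : ∫ x in Ω, ((0 : Lp ℝ 2 (volume.restrict Ω)) : Euc d → ℝ) x * fderiv ℝ φ x v = 0 :=
      integral_eq_zero_of_ae (h1.mono fun x hx => by
        simp only [hx, zero_mul, Pi.zero_apply])
    have e2 : ∫ x in Ω, inner ℝ (((0 : Lp (Euc d) 2 (volume.restrict Ω)) : Euc d → Euc d) x) v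
        * φ x = 0 :=
      integral_eq_zero_of_ae (h2.mono fun x hx => by
        simp only [hx, inner_zero_left, zero_mul, Pi.zero_apply])
    change ∫ x in Ω, ((0 : Lp ℝ 2 (volume.restrict Ω)) : Euc d → ℝ) x * fderiv ℝ φ x v
      = - ∫ x in Ω, inner ℝ (((0 : Lp (Euc d) 2 (volume.restrict Ω)) : Euc d → Euc d) x) v * φ x
    rw [e1, e2, neg_zero]
  add_mem' := by
    intro p q hp hq v φ hφ
    have i1 : ∀ r : Lp ℝ 2 (volume.restrict Ω),
        Integrable (fun x => r x * fderiv ℝ φ x v) (volume.restrict Ω) :=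
      fun r => (Lp.memLp r).integrable_mul (hφ.memLp_fderiv v)
    have i2 : ∀ r : Lp (Euc d) 2 (volume.restrict Ω),
        Integrable (fun x => inner ℝ (r x) v * φ x) (volume.restrict Ω) :=
      fun r => ((Lp.memLp r).inner_const v).integrable_mul hφ.memLp
    have e1 : ∫ x in Ω, (p.fst + q.fst : Lp ℝ 2 (volume.restrict Ω)) x * fderiv ℝ φ x v
        = ∫ x in Ω, (p.fst x * fderiv ℝ φ x v + q.fst x * fderiv ℝ φ x v) :=
      integral_congr_ae ((Lp.coeFn_add p.fst q.fst).mono fun x hx => by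
        simp only [hx, Pi.add_apply, add_mul])
    have e2 : ∫ x in Ω, inner ℝ ((p.snd + q.snd : Lp (Euc d) 2 (volume.restrict Ω)) x) v * φ x
        = ∫ x in Ω, (inner ℝ (p.snd x) v * φ x + inner ℝ (q.snd x) v * φ x) :=
      integral_congr_ae ((Lp.coeFn_add p.snd q.snd).mono fun x hx => by
        simp only [hx, Pi.add_apply, inner_add_left, add_mul])
    have e3 := hp v φ hφ
    have e4 := hq v φ hφ
    change ∫ x in Ω, (p.fst + q.fst : Lp ℝ 2 (volume.restrict Ω)) x * fderiv ℝ φ x v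
      = - ∫ x in Ω, inner ℝ ((p.snd + q.snd : Lp (Euc d) 2 (volume.restrict Ω)) x) v * φ x
    rw [e1, e2, integral_add (i1 _) (i1 _), integral_add (i2 _) (i2 _), e3, e4]
    ring
  smul_mem' := by
    intro c p hp v φ hφ
    have e1 : ∫ x in Ω, (c • p.fst : Lp ℝ 2 (volume.restrict Ω)) x * fderiv ℝ φ x v
        = ∫ x in Ω, c * (p.fst x * fderiv ℝ φ x v) :=
      integral_congr_ae ((Lp.coeFn_smul c p.fst).mono fun x hx => by
        simp only [hx, Pi.smul_apply, smul_eq_mul, mul_assoc])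
    have e2 : ∫ x in Ω, inner ℝ ((c • p.snd : Lp (Euc d) 2 (volume.restrict Ω)) x) v * φ x
        = ∫ x in Ω, c * (inner ℝ (p.snd x) v * φ x) :=
      integral_congr_ae ((Lp.coeFn_smul c p.snd).mono fun x hx => by
        simp only [hx, Pi.smul_apply, real_inner_smul_left, mul_assoc])
    have e3 := hp v φ hφ
    change ∫ x in Ω, (c • p.fst : Lp ℝ 2 (volume.restrict Ω)) x * fderiv ℝ φ x v
      = - ∫ x in Ω, inner ℝ ((c • p.snd : Lp (Euc d) 2 (volume.restrict Ω)) x) v * φ x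
    rw [e1, e2, integral_const_mul, integral_const_mul, e3]
    ring

/-- A function representing the class `u ∈ H¹(Ω)`. -/
def H1rep {Ω : Set (Euc d)} (u : H1 Ω) : Euc d → ℝ := u.1.fst

/-- `H¹₀(Ω)`: the closure of `C^∞_c(Ω)` in `H¹(Ω)`. -/
def H10 (Ω : Set (Euc d)) : Set (H1 Ω) :=
  closure {u | ∃ φ : Euc d → ℝ, IsTestFunction Ω φ ∧ H1rep u =ᵐ[volume.restrict Ω] φ}

/-- `u ∈ H¹(Ω) ∩ C⁰(Ω̄)`, with `f` a function that is continuous on `Ω̄` and represents `u`. -/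
def IsContRep {Ω : Set (Euc d)} (u : H1 Ω) (f : Euc d → ℝ) : Prop :=
  ContinuousOn f (closure Ω) ∧ H1rep u =ᵐ[volume.restrict Ω] f

/-- The closure of `H¹(Ω) ∩ C⁰(Ω̄)` in `H¹(Ω)`. -/
def H1tilde (Ω : Set (Euc d)) : Set (H1 Ω) :=
  closure {u | ∃ f : Euc d → ℝ, IsContRep u f}

/-! ### Chords, directional traces and directional measures -/

/-- `δ_θ(x) = sup {s ≥ 0 : x + tθ ∈ Ω for all t ∈ [0, s[}`. -/
def delta (Ω : Set (Euc d)) (θ x : Euc d) : ℝ :=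
  sSup {s : ℝ | 0 ≤ s ∧ ∀ t ∈ Ico 0 s, x + t • θ ∈ Ω}

/-- `Φ_θ(x) = x + δ_θ(x) θ`. -/
def Phi (Ω : Set (Euc d)) (θ x : Euc d) : Euc d := x + delta Ω θ x • θ

/-- The hyperplane `H_θ` orthogonal to `θ`. -/
abbrev Hyp (θ : Euc d) : Submodule ℝ (Euc d) := (Submodule.span ℝ {θ})ᗮ

/-- The Lebesgue measure `λ^{d-1}` on the Euclidean space `H_θ`. -/
def hypVolume (θ : Euc d) : Measure (Hyp θ) :=
  @volume (Hyp θ) measureSpaceOfInnerProductSpace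

/-- The projection `𝒫_θ(Ω)` of `Ω` on `H_θ`. -/
def projSet (Ω : Set (Euc d)) (θ : Euc d) : Set (Hyp θ) :=
  (Hyp θ).orthogonalProjectionOnto '' Ω

/-- `ω_θ(y) = {s : sθ + y ∈ Ω}`. -/
def slice (Ω : Set (Euc d)) (θ : Euc d) (y : Hyp θ) : Set ℝ :=
  {s | s • θ + (y : Euc d) ∈ Ω}

/-- `]α, β[ ∈ 𝓘_θ(y)`: it is one of the maximal open intervals that make up `ω_θ(y)`. -/
def IsChord (Ω : Set (Euc d)) (θ : Euc d) (y : Hyp θ) (α β : ℝ) : Prop :=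
  α < β ∧ Ioo α β ⊆ slice Ω θ y ∧ α ∉ slice Ω θ y ∧ β ∉ slice Ω θ y

/-- `g` is a directional trace of `u` in the direction `θ`. Boundary functions `∂Ω → ℝ` are
written as functions on the whole space, of which only the values on `∂Ω` matter. There are a
representative `u'` of `u` and a set `A` of full measure in `𝒫_θ(Ω)` such that, for `y ∈ A`,
the function `s ↦ u'(sθ + y)` is in `H¹(ω_θ(y))` and, for each `]α, β[ ∈ 𝓘_θ(y)`, the value
at `β` of its continuous representative on `]α, β]` is `g(βθ + y)`. -/
def IsDirTrace (Ω : Set (Euc d)) (θ : Euc d) (u g : Euc d → ℝ) : Prop :=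
  ∃ u' : Euc d → ℝ, u' =ᵐ[volume.restrict Ω] u ∧
    ∃ A ⊆ projSet Ω θ, hypVolume θ (projSet Ω θ \ A) = 0 ∧
      ∀ y ∈ A, MemW (slice Ω θ y) (1 : ℝ) (fun s => u' (s • θ + (y : Euc d))) ∧
        ∀ α β, IsChord Ω θ y α β → ∃ f : ℝ → ℝ, ContinuousOn f (Ioc α β) ∧
          (∀ᵐ s ∂(volume.restrict (Ioo α β)), f s = u' (s • θ + (y : Euc d))) ∧
          g (β • θ + (y : Euc d)) = f β

/-- The directional measure `μ_θ(A) = ∫_Ω χ_A(Φ_θ(x)) dx`, a measure carried by `∂Ω`. -/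
def dirMeasure (Ω : Set (Euc d)) (θ : Euc d) : Measure (Euc d) :=
  (volume.restrict Ω).map (Phi Ω θ)

section Carried

variable {Ω : Set (Euc d)} {θ x : Euc d}

theorem delta_nonneg : 0 ≤ delta Ω θ x := Real.sSup_nonneg fun _ hs => hs.1

theorem bddAbove_delta (hb : Bornology.IsBounded Ω) (hθ : ‖θ‖ = 1) :
    BddAbove {s : ℝ | 0 ≤ s ∧ ∀ t ∈ Ico 0 s, x + t • θ ∈ Ω} := by
  obtain ⟨C, hC⟩ := Metric.isBounded_iff.1 hb
  refine ⟨max C 0, fun s hs => le_of_not_gt fun hlt => ?_⟩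
  obtain ⟨t, ht1, ht2⟩ := exists_between hlt
  have ht0 : 0 < t := lt_of_le_of_lt (le_max_right _ _) ht1
  have h1 := hs.2 t ⟨ht0.le, ht2⟩
  have h0 := hs.2 0 ⟨le_rfl, ht0.trans ht2⟩
  have h2 := hC h1 h0
  rw [dist_eq_norm] at h2
  have h3 : x + t • θ - (x + (0 : ℝ) • θ) = t • θ := by simp
  rw [h3, norm_smul, hθ, mul_one, Real.norm_of_nonneg ht0.le] at h2
  exact absurd (le_max_left C 0) (not_le.2 (ht1.trans_le h2))

theorem le_delta (hb : Bornology.IsBounded Ω) (hθ : ‖θ‖ = 1) {s : ℝ} (hs : 0 ≤ s)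
    (h : ∀ t ∈ Ico 0 s, x + t • θ ∈ Ω) : s ≤ delta Ω θ x :=
  le_csSup (bddAbove_delta hb hθ) ⟨hs, h⟩

theorem mem_of_lt_delta {t : ℝ} (ht0 : 0 ≤ t) (ht : t < delta Ω θ x) : x + t • θ ∈ Ω := by
  obtain ⟨s, hs, hts⟩ := exists_lt_of_lt_csSup
    (s := {s : ℝ | 0 ≤ s ∧ ∀ t ∈ Ico 0 s, x + t • θ ∈ Ω}) ⟨0, le_rfl, by simp⟩ ht
  exact hs.2 t ⟨ht0, hts⟩

theorem exists_uniform (hΩ : IsOpen Ω) {r : ℝ} (h : ∀ t ∈ Icc 0 r, x + t • θ ∈ Ω) :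
    ∀ᶠ y in 𝓝 x, ∀ t ∈ Icc 0 r, y + t • θ ∈ Ω := by
  have := isCompact_Icc.eventually_forall_of_forall_eventually
    (x₀ := x) (K := Icc (0 : ℝ) r) (P := fun y t => y + t • θ ∈ Ω) (by
      intro t ht
      have hc : Continuous fun z : Euc d × ℝ => z.1 + z.2 • θ := by fun_prop
      exact hc.continuousAt.eventually_mem (hΩ.mem_nhds (h t ht)))
  exact this

theorem aemeasurable_Phi (hΩ : IsOpen Ω) (hb : Bornology.IsBounded Ω) (hθ : ‖θ‖ = 1) :
    AEMeasurable (Phi Ω θ) (volume.restrict Ω) := by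
  have key : AEMeasurable (delta Ω θ) (volume.restrict Ω) := by
    refine aemeasurable_restrict_of_measurable_subtype hΩ.measurableSet
      (measurable_of_Ioi fun l => ?_)
    have ho : IsOpen {y : Euc d | l < delta Ω θ y} := by
      refine isOpen_iff_mem_nhds.2 fun y (hy : l < delta Ω θ y) => ?_
      rcases lt_or_ge l 0 with hl | hl
      · exact Filter.univ_mem' fun z => hl.trans_le delta_nonneg
      · obtain ⟨r, hr1, hr2⟩ := exists_between hy
        have hr0 : 0 ≤ r := hl.trans hr1.le
        filter_upwards [exists_uniform (θ := θ) (r := r) hΩ fun t ht =>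
          mem_of_lt_delta ht.1 (ht.2.trans_lt hr2)] with z hz
        exact hr1.trans_le (le_delta hb hθ hr0 fun t ht => hz t ⟨ht.1, ht.2.le⟩)
    exact (ho.preimage continuous_subtype_val).measurableSet
  exact aemeasurable_id.add (key.smul_const θ)

theorem Phi_mem_frontier (hΩ : IsOpen Ω) (hb : Bornology.IsBounded Ω) (hθ : ‖θ‖ = 1)
    (hx : x ∈ Ω) : Phi Ω θ x ∈ frontier Ω := by
  have hc : Continuous fun t : ℝ => x + t • θ := by fun_prop
  have hnot : Phi Ω θ x ∉ Ω := by
    intro hmem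
    have hU : ∀ᶠ t in 𝓝 (delta Ω θ x), x + t • θ ∈ Ω :=
      hc.continuousAt.eventually_mem (hΩ.mem_nhds hmem)
    obtain ⟨ε, hε, hball⟩ := Metric.eventually_nhds_iff.1 hU
    have : delta Ω θ x + ε ≤ delta Ω θ x :=
      le_delta hb hθ (add_nonneg delta_nonneg hε.le) fun t ht => by
        rcases lt_or_ge t (delta Ω θ x) with h | h
        · exact mem_of_lt_delta ht.1 h
        · refine hball ?_
          rw [Real.dist_eq, abs_of_nonneg (sub_nonneg.2 h)]
          linarith [ht.2]
    linarith
  have hpos : delta Ω θ x ≠ 0 := by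
    intro h0
    apply hnot
    simpa [Phi, h0] using hx
  have hlt : 0 < delta Ω θ x := lt_of_le_of_ne delta_nonneg (Ne.symm hpos)
  rw [hΩ.frontier_eq]
  refine ⟨?_, hnot⟩
  have hcl : delta Ω θ x ∈ closure (Ico 0 (delta Ω θ x)) := by
    rw [closure_Ico hlt.ne]
    exact ⟨hlt.le, le_rfl⟩
  exact closure_mono (by rintro _ ⟨t, ht, rfl⟩; exact mem_of_lt_delta ht.1 ht.2)
    (image_closure_subset_closure_image hc (mem_image_of_mem _ hcl))

/-- `μ_θ` is carried by `∂Ω`. -/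
theorem dirMeasure_compl_frontier (hΩ : IsOpen Ω) (hb : Bornology.IsBounded Ω) (hθ : ‖θ‖ = 1) :
    dirMeasure Ω θ (frontier Ω)ᶜ = 0 := by
  rw [dirMeasure, Measure.map_apply_of_aemeasurable (aemeasurable_Phi hΩ hb hθ)
    isClosed_frontier.measurableSet.compl, Measure.restrict_apply' hΩ.measurableSet]
  convert measure_empty (μ := (volume : Measure (Euc d)))
  ext x
  simp only [mem_inter_iff, mem_preimage, mem_compl_iff, mem_empty_iff_false, iff_false, not_and]
  exact fun h hx => h (Phi_mem_frontier hΩ hb hθ hx)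

end Carried

/-! ### The space `L²(∂Ω, (μ_θ)_θ)` -/

/-- The unit sphere. -/
abbrev Sph (d : ℕ) : Set (Euc d) := Metric.sphere 0 1

/-- `g ∈ 𝓛²(∂Ω, (μ_θ)_θ)`: the function `g` is in `𝓛²(∂Ω, μ_θ)` for every `θ` (up to
modification on a `μ_θ`-negligible set), with a bound independent of `θ`. -/
def MemL2Bdry (Ω : Set (Euc d)) (g : Euc d → ℝ) : Prop :=
  ∃ M : ℝ, ∀ θ ∈ Sph d,
    MemLp g 2 (dirMeasure Ω θ) ∧ ∫ z, g z ^ 2 ∂(dirMeasure Ω θ) ≤ M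

/-- `g` and `h` define the same element of `L²(∂Ω, (μ_θ)_θ)`. -/
def BdryEquiv (Ω : Set (Euc d)) (g h : Euc d → ℝ) : Prop :=
  ∀ θ ∈ Sph d, g =ᵐ[dirMeasure Ω θ] h

/-- The norm of `L²(∂Ω, (μ_θ)_θ)`, with values in `[0, ∞]`. -/
def bdryNorm (Ω : Set (Euc d)) (g : Euc d → ℝ) : ℝ≥0∞ :=
  ⨆ θ ∈ Sph d, eLpNorm g 2 (dirMeasure Ω θ)

/-! ### Omnidirectional traces -/

/-- `g` is (a representative of) the omnidirectional trace of `u ∈ H¹(Ω)`: it is in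
`𝓛²(∂Ω, (μ_θ)_θ)`, and for every `θ` it equals `μ_θ`-a.e. the directional trace of `u`. -/
def IsOmniTrace {Ω : Set (Euc d)} (u : H1 Ω) (g : Euc d → ℝ) : Prop :=
  MemL2Bdry Ω g ∧
    ∀ θ ∈ Sph d, ∃ h : Euc d → ℝ, IsDirTrace Ω θ (H1rep u) h ∧ h =ᵐ[dirMeasure Ω θ] g

/-- `H¹_tr(Ω)`: the elements of `H¹(Ω)` that have an omnidirectional trace. -/
def H1tr (Ω : Set (Euc d)) : Set (H1 Ω) := {u | ∃ g, IsOmniTrace u g}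

/-- `H¹_{tr,0}(Ω)`: the elements of `H¹_tr(Ω)` with `tr(u) = 0` in `L²(∂Ω, (μ_θ)_θ)`. -/
def H1tr0 (Ω : Set (Euc d)) : Set (H1 Ω) := {u | ∃ g, IsOmniTrace u g ∧ BdryEquiv Ω g 0}

end OmniTrace

end

open OmniTrace

/-!
On almost every line of direction `θ` a function `u ∈ H¹(Ω)` is absolutely continuous on each chord
`]α, β[`, where `(β - α) |u(β)|² ≤ C² ∫ (u² + u'²)` with `C` depending only on the size of `Ω`. The
map `Φ_θ` sends the whole chord to its right end, so `β - α` is exactly the `μ_θ`-weight of that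
end, and integrating over the lines gives the trace inequality `‖g‖_{L²(μ_θ)} ≤ C ‖u‖_{H¹(Ω)}`,
uniformly in `θ`. The boundary values of a sequence of continuous functions converging in `H¹(Ω)`
are therefore a Cauchy sequence for the uniform norm; along a fast subsequence they converge
`μ_θ`-a.e. for every `θ`, and the pointwise limit does not depend on `θ`: it is the trace.

If the traces in the directions `θ` and `-θ` vanish, then `u` vanishes at both ends of almost every
chord, integration by parts along the chords has no boundary term, and the extension of `u` by zero
is in `H¹(ℝ^d)`. Its mollifications are continuous functions that approximate `u` in `H¹(Ω)`.
-/

open MeasureTheory Set Filter Topology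
open scoped ENNReal ContDiff

noncomputable section

namespace OmniTrace

section Lines

variable {d : ℕ} {θ : Euc d} {Ω : Set (Euc d)}

instance (θ : Euc d) : SFinite (hypVolume θ) := by
  unfold hypVolume; infer_instance

/-- The parametrisation `s ↦ sθ + y` of the line of direction `θ` through `y ∈ H_θ`, so that
`slice Ω θ y` is by definition `line θ y ⁻¹' Ω`. -/
def line (θ : Euc d) (y : Hyp θ) (s : ℝ) : Euc d := s • θ + (y : Euc d)

theorem continuous_line (y : Hyp θ) : Continuous (line θ y) := by
  unfold line; fun_prop

theorem continuous_uncurry_line (θ : Euc d) : Continuous (Function.uncurry (line θ)) := by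
  unfold line Function.uncurry; fun_prop

theorem inner_hyp (y : Hyp θ) : inner ℝ θ (y : Euc d) = 0 :=
  Submodule.mem_orthogonal_singleton_iff_inner_right.1 y.2

theorem inner_line (hθ : ‖θ‖ = 1) (y : Hyp θ) (s : ℝ) : inner ℝ θ (line θ y s) = s := by
  rw [line, inner_add_right, real_inner_smul_right, real_inner_self_eq_norm_sq, hθ, inner_hyp]
  ring

theorem orthogonalProjectionOnto_line (y : Hyp θ) (s : ℝ) :
    (Hyp θ).orthogonalProjectionOnto (line θ y s) = y := by
  have hproj : (Hyp θ).orthogonalProjectionOnto θ = 0 :=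
    Submodule.orthogonalProjectionOnto_orthogonal_apply_eq_zero
      (Submodule.mem_span_singleton_self θ)
  simp [line, hproj]

theorem exists_line_eq (hθ : ‖θ‖ = 1) (x : Euc d) : ∃ y s, line θ y s = x := by
  have hx : x - inner ℝ θ x • θ ∈ Hyp θ := by
    rw [Submodule.mem_orthogonal_singleton_iff_inner_right, inner_sub_right, real_inner_smul_right,
      real_inner_self_eq_norm_sq, hθ]
    ring
  exact ⟨⟨_, hx⟩, inner ℝ θ x, add_sub_cancel _ _⟩

theorem isOpen_slice (hΩ : IsOpen Ω) (y : Hyp θ) : IsOpen (slice Ω θ y) :=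
  hΩ.preimage (continuous_line y)

theorem measurableSet_slice (hΩ : MeasurableSet Ω) (y : Hyp θ) : MeasurableSet (slice Ω θ y) :=
  hΩ.preimage (continuous_line y).measurable

theorem mem_projSet_of_mem_slice {y : Hyp θ} {s : ℝ} (hs : s ∈ slice Ω θ y) : y ∈ projSet Ω θ :=
  ⟨_, hs, orthogonalProjectionOnto_line y s⟩

theorem measurePreserving_uncurry_line (hθ : ‖θ‖ = 1) :
    MeasurePreserving (Function.uncurry (line θ)) ((hypVolume θ).prod volume) volume := by
  let _ : MeasureSpace (Hyp θ) := measureSpaceOfInnerProductSpace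
  have hspan : MeasurePreserving (LinearIsometryEquiv.toSpanUnitSingleton (𝕜 := ℝ) θ hθ) :=
    (LinearIsometryEquiv.toSpanUnitSingleton (𝕜 := ℝ) θ hθ).measurePreserving
  have hdecomp :=
    (ℝ ∙ θ).orthogonalDecomposition.symm.measurePreserving.comp
      (WithLp.volume_preserving_toLp (ℝ ∙ θ) (ℝ ∙ θ)ᗮ)
  convert! (hdecomp.comp (hspan.prod (.id volume))).comp Measure.measurePreserving_swap using 1

section Fubini

variable (hθ : ‖θ‖ = 1) (hΩ : MeasurableSet Ω)
include hθ hΩ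

theorem lintegral_lines {F : Euc d → ℝ≥0∞} (hF : AEMeasurable F (volume.restrict Ω)) :
    ∫⁻ x in Ω, F x = ∫⁻ y, (∫⁻ s in slice Ω θ y, F (line θ y s)) ∂(hypVolume θ) := by
  have hm := measurePreserving_uncurry_line hθ
  have hF' : AEMeasurable (Ω.indicator F) volume := (aemeasurable_indicator_iff hΩ).2 hF
  rw [← lintegral_indicator hΩ, ← hm.map_eq,
    lintegral_map' (by rwa [hm.map_eq]) hm.measurable.aemeasurable]
  refine (lintegral_prod _
    (hF'.comp_quasiMeasurePreserving hm.quasiMeasurePreserving)).trans (lintegral_congr fun y => ?_)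
  rw [← lintegral_indicator (measurableSet_slice hΩ y)]
  rfl

theorem aemeasurable_lintegral_lines {F : Euc d → ℝ≥0∞}
    (hF : AEMeasurable F (volume.restrict Ω)) :
    AEMeasurable (fun y => ∫⁻ s in slice Ω θ y, F (line θ y s)) (hypVolume θ) := by
  have hm := (measurePreserving_uncurry_line hθ).quasiMeasurePreserving
  have hF' : AEMeasurable (Ω.indicator F) volume := (aemeasurable_indicator_iff hΩ).2 hF
  refine (hF'.comp_quasiMeasurePreserving hm).lintegral_prod_right'.congr
    (Eventually.of_forall fun y => ?_)
  exact lintegral_indicator (measurableSet_slice hΩ y) (F ∘ line θ y)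

theorem ae_lines {P : Euc d → Prop} (h : ∀ᵐ x ∂(volume.restrict Ω), P x) :
    ∀ᵐ y ∂(hypVolume θ), ∀ᵐ s ∂(volume.restrict (slice Ω θ y)), P (line θ y s) := by
  have hm := measurePreserving_uncurry_line hθ
  rw [ae_restrict_iff' hΩ] at h
  filter_upwards [Measure.ae_ae_of_ae_prod (hm.quasiMeasurePreserving.ae h)] with y hy
  rwa [ae_restrict_iff' (measurableSet_slice hΩ y)]

theorem memLp_lines {F : Type*} [NormedAddCommGroup F] {p : ℝ≥0∞} (hp : p ≠ 0) (hp' : p ≠ ⊤)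
    {f : Euc d → F} (hf : MemLp f p (volume.restrict Ω)) :
    ∀ᵐ y ∂(hypVolume θ), MemLp (f ∘ line θ y) p (volume.restrict (slice Ω θ y)) := by
  have hprod : MemLp (Ω.indicator f ∘ Function.uncurry (line θ)) p ((hypVolume θ).prod volume) :=
    ((memLp_indicator_iff_restrict hΩ).2 hf).comp_measurePreserving
      (measurePreserving_uncurry_line hθ)
  filter_upwards [((integrable_norm_rpow_iff hprod.1 hp hp').2 hprod).prod_right_ae,
    hprod.1.prodMk_left] with y hint hmeas
  rw [← memLp_indicator_iff_restrict (measurableSet_slice hΩ y)]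
  exact (integrable_norm_rpow_iff hmeas hp hp').1 hint

theorem integrable_integral_lines {F : Type*} [NormedAddCommGroup F] [NormedSpace ℝ F]
    {f : Euc d → F} (hf : IntegrableOn f Ω) :
    Integrable (fun y => ∫ s in slice Ω θ y, f (line θ y s)) (hypVolume θ) := by
  have hprod := (measurePreserving_uncurry_line hθ).integrable_comp_of_integrable
    ((integrable_indicator_iff hΩ).2 hf)
  refine hprod.integral_prod_left.congr (Eventually.of_forall fun y => ?_)
  exact integral_indicator (f := f ∘ line θ y) (measurableSet_slice hΩ y)

theorem integral_lines {F : Type*} [NormedAddCommGroup F] [NormedSpace ℝ F]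
    {f : Euc d → F} (hf : IntegrableOn f Ω) :
    ∫ x in Ω, f x = ∫ y, (∫ s in slice Ω θ y, f (line θ y s)) ∂(hypVolume θ) := by
  have hm := measurePreserving_uncurry_line hθ
  have hf' : Integrable (Ω.indicator f) volume := (integrable_indicator_iff hΩ).2 hf
  rw [← integral_indicator hΩ, ← hm.map_eq,
    integral_map hm.measurable.aemeasurable (by rw [hm.map_eq]; exact hf'.1)]
  refine (integral_prod _ (hm.integrable_comp_of_integrable hf')).trans
    (integral_congr_ae (Eventually.of_forall fun y => ?_))
  exact integral_indicator (f := f ∘ line θ y) (measurableSet_slice hΩ y)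

end Fubini

end Lines

section TestFunctions

variable {E : Type*} [NormedAddCommGroup E] [NormedSpace ℝ E] {Ω Ω' : Set E} {φ ψ : E → ℝ}

namespace IsTestFunction

theorem mono (hφ : IsTestFunction Ω φ) (h : Ω ⊆ Ω') : IsTestFunction Ω' φ :=
  ⟨hφ.smooth, hφ.compact, hφ.supp.trans h⟩

theorem eq_zero_of_notMem (hφ : IsTestFunction Ω φ) {x : E} (hx : x ∉ Ω) : φ x = 0 :=
  image_eq_zero_of_notMem_tsupport fun h => hx (hφ.supp h)

theorem fderiv_eq_zero_of_notMem (hφ : IsTestFunction Ω φ) {x : E} (hx : x ∉ Ω) :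
    fderiv ℝ φ x = 0 :=
  image_eq_zero_of_notMem_tsupport fun h => hx (hφ.supp (tsupport_fderiv_subset ℝ h))

theorem const_mul (hφ : IsTestFunction Ω φ) (c : ℝ) : IsTestFunction Ω (fun x => c * φ x) :=
  ⟨contDiff_const.mul hφ.smooth, hφ.compact.mul_left, tsupport_mul_subset_right.trans hφ.supp⟩

theorem sub (hφ : IsTestFunction Ω φ) (hψ : IsTestFunction Ω ψ) :
    IsTestFunction Ω (fun x => φ x - ψ x) :=
  ⟨hφ.smooth.sub hψ.smooth, hφ.compact.sub hψ.compact,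
    (tsupport_sub _ _).trans (union_subset hφ.supp hψ.supp)⟩

theorem translate (hφ : IsTestFunction univ φ) (t : E) :
    IsTestFunction univ fun x => φ (x + t) :=
  ⟨hφ.smooth.comp (contDiff_id.add contDiff_const),
    hφ.compact.comp_homeomorph (Homeomorph.addRight t), subset_univ _⟩

section Measure

variable [MeasurableSpace E] [BorelSpace E] {μ : Measure E}

theorem integrable [IsFiniteMeasureOnCompacts μ] (hφ : IsTestFunction Ω φ) : Integrable φ μ :=
  hφ.smooth.continuous.integrable_of_hasCompactSupport hφ.compact

theorem integrable_mul (hφ : IsTestFunction Ω φ) {u : E → ℝ} (hu : Integrable u μ) :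
    Integrable (fun x => u x * φ x) μ := by
  obtain ⟨C, hC⟩ := hφ.compact.exists_bound_of_continuous hφ.smooth.continuous
  exact hu.mul_bdd hφ.smooth.continuous.aestronglyMeasurable (Eventually.of_forall hC)

end Measure

end IsTestFunction

theorem exists_isTestFunction_integral_eq_one [FiniteDimensional ℝ E] [MeasureSpace E]
    [BorelSpace E] [IsFiniteMeasureOnCompacts (volume : Measure E)]
    [(volume : Measure E).IsOpenPosMeasure] (hΩ : IsOpen Ω) (hne : Ω.Nonempty) :
    ∃ ρ : E → ℝ, IsTestFunction Ω ρ ∧ (∀ x, 0 ≤ ρ x) ∧ ∫ x, ρ x = 1 := by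
  obtain ⟨x, hx⟩ := hne
  obtain ⟨r, hr, hball⟩ := Metric.nhds_basis_closedBall.mem_iff.1 (hΩ.mem_nhds hx)
  let B : ContDiffBump x := ⟨r / 2, r, half_pos hr, half_lt_self hr⟩
  refine ⟨B.normed volume, ⟨B.contDiff_normed, B.hasCompactSupport_normed, ?_⟩,
    B.nonneg_normed, B.integral_normed⟩
  rwa [B.tsupport_normed_eq]

theorem IsWeakDirDeriv.mono [MeasureSpace E] [OpensMeasurableSpace E] {v : E} {u w : E → ℝ}
    (h : IsWeakDirDeriv Ω' v u w) (hΩ' : IsOpen Ω') (hsub : Ω ⊆ Ω') : IsWeakDirDeriv Ω v u w := by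
  intro φ hφ
  have h' := h φ (hφ.mono hsub)
  rwa [setIntegral_eq_of_subset_of_forall_sdiff_eq_zero hΩ'.measurableSet hsub fun x hx => by
      rw [hφ.fderiv_eq_zero_of_notMem hx.2, _root_.zero_apply, mul_zero],
    setIntegral_eq_of_subset_of_forall_sdiff_eq_zero hΩ'.measurableSet hsub fun x hx => by
      rw [hφ.eq_zero_of_notMem hx.2, mul_zero]] at h'

end TestFunctions

section Interval

variable {α β : ℝ} {u w φ ρ : ℝ → ℝ}

theorem intervalIntegral_eq_setIntegral_Ioo (hαβ : α ≤ β) (w : ℝ → ℝ) :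
    ∫ s in α..β, w s = ∫ s in Ioo α β, w s := by
  rw [intervalIntegral.integral_of_le hαβ, integral_Ioc_eq_integral_Ioo]

theorem IsTestFunction.deriv (hφ : IsTestFunction (Ioo α β) φ) :
    IsTestFunction (Ioo α β) (deriv φ) :=
  ⟨(contDiff_infty_iff_deriv.1 hφ.smooth).2, hφ.compact.deriv,
    (tsupport_deriv_subset).trans hφ.supp⟩

theorem exists_subset_Icc_of_isCompact {K : Set ℝ} (hK : IsCompact K) (hsub : K ⊆ Ioo α β) :
    ∃ a b, K ⊆ Icc a b ∧ α < a ∧ b < β := by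
  rcases K.eq_empty_or_nonempty with rfl | hne
  · exact ⟨α + 1, β - 1, empty_subset _, lt_add_one α, sub_one_lt β⟩
  · exact ⟨sInf K, sSup K, fun t ht => ⟨csInf_le hK.bddBelow ht, le_csSup hK.bddAbove ht⟩,
      (hsub (hK.sInf_mem hne)).1, (hsub (hK.sSup_mem hne)).2⟩

theorem support_primitive_subset_Icc {a b : ℝ} (hφ : Function.support φ ⊆ Icc a b) (hα : α < a)
    (h0 : ∫ s, φ s = 0) : Function.support (fun s => ∫ t in α..s, φ t) ⊆ Icc a b := by
  refine fun s hs => by_contra fun hmem => hs ?_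
  rcases lt_or_ge s a with hsa | hsa
  · refine intervalIntegral.integral_zero_ae (Eventually.of_forall fun t ht => ?_)
    exact Function.notMem_support.1 fun hmemt =>
      (ht.2.trans_lt (max_lt hα hsa)).not_ge (hφ hmemt).1
  · have hbs : b < s := not_le.1 fun hsb => hmem ⟨hsa, hsb⟩
    rw [← h0]
    exact intervalIntegral.integral_eq_integral_of_support_subset fun t ht =>
      ⟨hα.trans_le (hφ ht).1, (hφ ht).2.trans hbs.le⟩

theorem IsTestFunction.primitive (hφ : IsTestFunction (Ioo α β) φ) (h0 : ∫ s, φ s = 0) :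
    IsTestFunction (Ioo α β) (fun s => ∫ t in α..s, φ t) := by
  have hderiv : ∀ s, HasDerivAt (fun s => ∫ t in α..s, φ t) (φ s) s := fun s =>
    (hφ.smooth.continuous.integral_hasStrictDerivAt α s).hasDerivAt
  obtain ⟨a, b, hab, hα, hβ⟩ := exists_subset_Icc_of_isCompact hφ.compact hφ.supp
  have hsub : tsupport (fun s => ∫ t in α..s, φ t) ⊆ Icc a b :=
    closure_minimal (support_primitive_subset_Icc ((subset_tsupport φ).trans hab) hα h0)
      isClosed_Icc
  refine ⟨contDiff_infty_iff_deriv.2 ⟨fun s => (hderiv s).differentiableAt, ?_⟩,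
    isCompact_Icc.of_isClosed_subset (isClosed_tsupport _) hsub,
    hsub.trans (Icc_subset_Ioo hα hβ)⟩
  rw [funext fun s => (hderiv s).deriv]
  exact hφ.smooth

theorem integral_mul_eq_of_integral_mul_deriv_eq_zero (hu : IntegrableOn u (Ioo α β))
    (h : ∀ ψ, IsTestFunction (Ioo α β) ψ → ∫ s in Ioo α β, u s * deriv ψ s = 0)
    (hρ : IsTestFunction (Ioo α β) ρ) (hρ1 : ∫ s, ρ s = 1) (hφ : IsTestFunction (Ioo α β) φ) :
    ∫ s in Ioo α β, u s * φ s = (∫ s in Ioo α β, u s * ρ s) * ∫ s, φ s := by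
  set m := ∫ s, φ s
  have hχ : IsTestFunction (Ioo α β) (fun s => φ s - m * ρ s) := hφ.sub (hρ.const_mul m)
  have hχ0 : ∫ s, (φ s - m * ρ s) = 0 := by
    rw [integral_sub hφ.integrable (hρ.integrable.const_mul m), integral_const_mul, hρ1, mul_one,
      sub_self]
  have hzero := h _ (hχ.primitive hχ0)
  simp only [hχ.smooth.continuous.deriv_integral _ α, mul_sub, mul_left_comm _ m] at hzero
  rw [integral_sub (hφ.integrable_mul hu) ((hρ.integrable_mul hu).const_mul m),
    integral_const_mul] at hzero
  linarith

theorem exists_ae_eq_const_of_integral_mul_deriv_eq_zero (hαβ : α < β)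
    (hu : IntegrableOn u (Ioo α β))
    (h : ∀ ψ, IsTestFunction (Ioo α β) ψ → ∫ s in Ioo α β, u s * deriv ψ s = 0) :
    ∃ c, ∀ᵐ s ∂(volume.restrict (Ioo α β)), u s = c := by
  obtain ⟨ρ, hρ, -, hρ1⟩ :=
    exists_isTestFunction_integral_eq_one isOpen_Ioo (nonempty_Ioo.2 hαβ)
  set c := ∫ s in Ioo α β, u s * ρ s
  have huc : IntegrableOn (fun s => u s - c) (Ioo α β) := hu.sub (integrableOn_const (by simp))
  refine ⟨c, ?_⟩
  rw [ae_restrict_iff' measurableSet_Ioo]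
  refine (isOpen_Ioo.ae_eq_zero_of_integral_contDiff_smul_eq_zero huc.locallyIntegrableOn
    fun φ hφ hφc hφs => ?_).mono fun s hs hmem => sub_eq_zero.1 (hs hmem)
  have hφ : IsTestFunction (Ioo α β) φ := ⟨hφ, hφc, hφs⟩
  have hout : ∀ s ∉ Ioo α β, φ s = 0 := fun s => hφ.eq_zero_of_notMem
  calc ∫ s, φ s • (u s - c)
      = ∫ s in Ioo α β, φ s • (u s - c) :=
        (setIntegral_eq_integral_of_forall_compl_eq_zero fun s hs => by
          rw [hout s hs, zero_smul]).symm
    _ = ∫ s in Ioo α β, (u s * φ s - c * φ s) := by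
        congr 1; ext s; rw [smul_eq_mul]; ring
    _ = (∫ s in Ioo α β, u s * φ s) - c * ∫ s, φ s := by
        rw [integral_sub (hφ.integrable_mul hu) (hφ.integrable.const_mul c), integral_const_mul,
          setIntegral_eq_integral_of_forall_compl_eq_zero hout]
    _ = 0 := sub_eq_zero.2 (integral_mul_eq_of_integral_mul_deriv_eq_zero hu h hρ hρ1 hφ)

theorem absolutelyContinuousOnInterval_primitive (hw : IntervalIntegrable w volume α β) (c : ℝ) :
    AbsolutelyContinuousOnInterval (fun s => c + ∫ t in α..s, w t) α β := by
  have hc : AbsolutelyContinuousOnInterval (fun _ : ℝ => c) α β :=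
    (contDiff_const.contDiffOn (𝕜 := ℝ)).absolutelyContinuousOnInterval
  exact hc.add (hw.absolutelyContinuousOnInterval_intervalIntegral left_mem_uIcc)

theorem integral_primitive_mul_deriv (hw : IntervalIntegrable w volume α β) (c : ℝ)
    (hφ : AbsolutelyContinuousOnInterval φ α β) :
    ∫ s in α..β, (c + ∫ t in α..s, w t) * deriv φ s
      = (c + ∫ t in α..β, w t) * φ β - c * φ α - ∫ s in α..β, w s * φ s := by
  have hderiv : ∫ s in α..β, deriv (fun s => c + ∫ t in α..s, w t) s * φ s
      = ∫ s in α..β, w s * φ s := by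
    refine intervalIntegral.integral_congr_ae ?_
    filter_upwards [hw.ae_hasDerivAt_integral] with s hs hmem
    rw [((hs (uIoc_subset_uIcc hmem) α left_mem_uIcc).const_add c).deriv]
  rw [(absolutelyContinuousOnInterval_primitive hw c).integral_mul_deriv_eq_deriv_mul hφ, hderiv,
    intervalIntegral.integral_same, add_zero]

theorem IsTestFunction.absolutelyContinuousOnInterval {Ω : Set ℝ} (hφ : IsTestFunction Ω φ)
    (α β : ℝ) : AbsolutelyContinuousOnInterval φ α β :=
  (hφ.smooth.of_le (by simp)).contDiffOn.absolutelyContinuousOnInterval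

theorem exists_ae_eq_primitive (hαβ : α < β) (hu : IntegrableOn u (Ioo α β))
    (hw : IntegrableOn w (Ioo α β)) (h : IsWeakDirDeriv (Ioo α β) (1 : ℝ) u w) :
    ∃ c, ∀ᵐ s ∂(volume.restrict (Ioo α β)), u s = c + ∫ t in α..s, w t := by
  have hw' : IntervalIntegrable w volume α β :=
    (intervalIntegrable_iff_integrableOn_Ioo_of_le hαβ.le).2 hw
  have hW : IntegrableOn (fun s => 0 + ∫ t in α..s, w t) (Ioo α β) :=
    (uIcc_of_le hαβ.le ▸ (absolutelyContinuousOnInterval_primitive hw' 0).continuousOn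
      |>.integrableOn_Icc).mono_set Ioo_subset_Icc_self
  obtain ⟨c, hc⟩ := exists_ae_eq_const_of_integral_mul_deriv_eq_zero hαβ (hu.sub hW) fun ψ hψ => by
    have hparts := integral_primitive_mul_deriv hw' 0 (hψ.absolutelyContinuousOnInterval α β)
    rw [hψ.eq_zero_of_notMem (fun hβ => hβ.2.false), hψ.eq_zero_of_notMem (fun hα => hα.1.false)]
      at hparts
    simp only [intervalIntegral_eq_setIntegral_Ioo hαβ.le] at hparts
    have hweak := h ψ hψ
    simp only [fderiv_apply_one_eq_deriv] at hweak
    simp only [Pi.sub_apply, sub_mul]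
    rw [integral_sub (hψ.deriv.integrable_mul hu) (hψ.deriv.integrable_mul hW), hweak, hparts]
    ring
  refine ⟨c, hc.mono fun s hs => ?_⟩
  simp only [Pi.sub_apply] at hs
  linarith

end Interval

section Chords

theorem exists_Ioo_maximal_of_isOpen {S : Set ℝ} (hS : IsOpen S) (hb : Bornology.IsBounded S)
    {s : ℝ} (hs : s ∈ S) : ∃ α β, s ∈ Ioo α β ∧ Ioo α β ⊆ S ∧ α ∉ S ∧ β ∉ S := by
  have hright : (Sᶜ ∩ Ici s).Nonempty := by
    obtain ⟨t, ht⟩ := hb.bddAbove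
    exact ⟨t + 1, fun h => (lt_add_one t).not_ge (ht h), (ht hs).trans (lt_add_one t).le⟩
  have hleft : (Sᶜ ∩ Iic s).Nonempty := by
    obtain ⟨t, ht⟩ := hb.bddBelow
    exact ⟨t - 1, fun h => (sub_one_lt t).not_ge (ht h), (sub_one_lt t).le.trans (ht hs)⟩
  have hbelow : BddBelow (Sᶜ ∩ Ici s) := ⟨s, fun t ht => ht.2⟩
  have habove : BddAbove (Sᶜ ∩ Iic s) := ⟨s, fun t ht => ht.2⟩
  obtain ⟨hβS, hβ⟩ := (hS.isClosed_compl.inter isClosed_Ici).csInf_mem hright hbelow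
  obtain ⟨hαS, hα⟩ := (hS.isClosed_compl.inter isClosed_Iic).csSup_mem hleft habove
  refine ⟨_, _, ⟨lt_of_le_of_ne hα fun h => hαS (h.symm ▸ hs),
    lt_of_le_of_ne hβ fun h => hβS (h ▸ hs)⟩, fun t ht => by_contra fun htS => ?_, hαS, hβS⟩
  rcases le_total s t with hst | hts
  · exact (csInf_le hbelow ⟨htS, hst⟩).not_gt ht.2
  · exact (le_csSup habove ⟨htS, hts⟩).not_gt ht.1

variable {d : ℕ} {θ : Euc d} {Ω : Set (Euc d)} {y : Hyp θ} {α β α' β' s R : ℝ}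

theorem slice_subset_Icc (hθ : ‖θ‖ = 1) (hR : Ω ⊆ Metric.closedBall 0 R) (y : Hyp θ) :
    slice Ω θ y ⊆ Icc (-R) R := by
  intro s hs
  have hinner := abs_real_inner_le_norm θ (line θ y s)
  rw [inner_line hθ, hθ, one_mul] at hinner
  exact abs_le.1 (hinner.trans (mem_closedBall_zero_iff.1 (hR hs)))

theorem isBounded_slice (hθ : ‖θ‖ = 1) (hb : Bornology.IsBounded Ω) (y : Hyp θ) :
    Bornology.IsBounded (slice Ω θ y) := by
  obtain ⟨R, hR⟩ := hb.subset_closedBall 0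
  exact (Metric.isBounded_Icc (-R) R).subset (slice_subset_Icc hθ hR y)

theorem exists_isChord (hθ : ‖θ‖ = 1) (hΩ : IsOpen Ω) (hb : Bornology.IsBounded Ω)
    (hs : s ∈ slice Ω θ y) : ∃ α β, IsChord Ω θ y α β ∧ s ∈ Ioo α β := by
  obtain ⟨α, β, hmem, hsub, hα, hβ⟩ :=
    exists_Ioo_maximal_of_isOpen (isOpen_slice hΩ y) (isBounded_slice hθ hb y) hs
  exact ⟨α, β, ⟨hmem.1.trans hmem.2, hsub, hα, hβ⟩, hmem⟩

namespace IsChord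

theorem eq_of_mem (h : IsChord Ω θ y α β) (h' : IsChord Ω θ y α' β')
    (hs : s ∈ Ioo α β) (hs' : s ∈ Ioo α' β') : α = α' ∧ β = β' := by
  obtain ⟨-, hsub, hα, hβ⟩ := h
  obtain ⟨-, hsub', hα', hβ'⟩ := h'
  exact ⟨le_antisymm (not_lt.1 fun hlt => hα (hsub' ⟨hlt, hs.1.trans hs'.2⟩))
      (not_lt.1 fun hlt => hα' (hsub ⟨hlt, hs'.1.trans hs.2⟩)),
    le_antisymm (not_lt.1 fun hlt => hβ' (hsub ⟨hs.1.trans hs'.2, hlt⟩))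
      (not_lt.1 fun hlt => hβ (hsub' ⟨hs'.1.trans hs.2, hlt⟩))⟩

theorem sub_le (h : IsChord Ω θ y α β) (hθ : ‖θ‖ = 1) (hR : Ω ⊆ Metric.closedBall 0 R) :
    β - α ≤ 2 * R := by
  have hsub : Icc α β ⊆ Icc (-R) R := by
    rw [← closure_Ioo h.1.ne]
    exact closure_minimal (h.2.1.trans (slice_subset_Icc hθ hR y)) isClosed_Icc
  linarith [(hsub (left_mem_Icc.2 h.1.le)).1, (hsub (right_mem_Icc.2 h.1.le)).2]

theorem Phi_eq (h : IsChord Ω θ y α β) (hθ : ‖θ‖ = 1) (hb : Bornology.IsBounded Ω)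
    (hs : s ∈ Ioo α β) : Phi Ω θ (line θ y s) = line θ y β := by
  have hshift : ∀ t : ℝ, line θ y s + t • θ = line θ y (s + t) := fun t => by
    simp only [line, add_smul]; abel
  have hle : 0 ≤ β - s := sub_nonneg.2 hs.2.le
  have hdelta : delta Ω θ (line θ y s) = β - s := by
    refine le_antisymm (le_of_not_gt fun hlt => h.2.2.2 ?_)
      (le_delta hb hθ hle fun t ht => ?_)
    · have hmem := mem_of_lt_delta hle hlt
      rwa [hshift, add_sub_cancel] at hmem
    · rw [hshift]
      exact h.2.1 ⟨by linarith [ht.1, hs.1], by linarith [ht.2]⟩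
  rw [Phi, hdelta, hshift, add_sub_cancel]

theorem mem_frontier (h : IsChord Ω θ y α β) (hθ : ‖θ‖ = 1) (hΩ : IsOpen Ω)
    (hb : Bornology.IsBounded Ω) : line θ y β ∈ frontier Ω := by
  obtain ⟨s, hs⟩ := nonempty_Ioo.2 h.1
  rw [← h.Phi_eq hθ hb hs]
  exact Phi_mem_frontier hΩ hb hθ (h.2.1 hs)

theorem neg (h : IsChord Ω θ y α β) {y' : Hyp (-θ)} (hy : (y' : Euc d) = y) :
    IsChord Ω (-θ) y' (-β) (-α) := by
  have hmem : ∀ t, t ∈ slice Ω (-θ) y' ↔ -t ∈ slice Ω θ y := fun t => by simp [slice, hy]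
  refine ⟨neg_lt_neg h.1,
    fun t ht => (hmem t).2 (h.2.1 ⟨lt_neg_of_lt_neg ht.2, neg_lt_of_neg_lt ht.1⟩), ?_, ?_⟩
  · rw [hmem, neg_neg]; exact h.2.2.2
  · rw [hmem, neg_neg]; exact h.2.2.1

end IsChord

theorem Hyp_neg (θ : Euc d) : Hyp (-θ) = Hyp θ := by
  rw [Hyp, ← Set.neg_singleton, Submodule.span_neg]

theorem ae_hyp_neg {P : Euc d → Prop} (h : ∀ᵐ y : Hyp (-θ) ∂(hypVolume (-θ)), P y) :
    ∀ᵐ y : Hyp θ ∂(hypVolume θ), P y := by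
  have hcongr : ∀ {p q : Submodule ℝ (Euc d)}, p = q →
      (∀ᵐ y : p ∂(@volume p measureSpaceOfInnerProductSpace), P y) →
      ∀ᵐ y : q ∂(@volume q measureSpaceOfInnerProductSpace), P y := by
    rintro p _ rfl h
    exact h
  exact hcongr (Hyp_neg θ) h

/-- The set of the pairs `(α, β)` such that `]α, β[` is a chord of `Ω` on the line
`y + ℝθ`. -/
def chords (Ω : Set (Euc d)) (θ : Euc d) (y : Hyp θ) : Set (ℝ × ℝ) := {p | IsChord Ω θ y p.1 p.2}

theorem pairwiseDisjoint_chords : (chords Ω θ y).PairwiseDisjoint fun p => Ioo p.1 p.2 :=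
  fun _ hp _ hq hpq => Set.disjoint_left.2 fun _ hs hs' =>
    hpq (Prod.ext_iff.2 (IsChord.eq_of_mem hp hq hs hs'))

theorem countable_chords : (chords Ω θ y).Countable :=
  pairwiseDisjoint_chords.countable_of_isOpen (fun _ _ => isOpen_Ioo)
    fun _ hp => nonempty_Ioo.2 hp.1

section

variable (hθ : ‖θ‖ = 1) (hΩ : IsOpen Ω) (hb : Bornology.IsBounded Ω)
include hθ hΩ hb

theorem slice_eq_iUnion_chords : slice Ω θ y = ⋃ p ∈ chords Ω θ y, Ioo p.1 p.2 := by
  refine Subset.antisymm (fun s hs => ?_) (iUnion₂_subset fun p hp => hp.2.1)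
  obtain ⟨α, β, hchord, hmem⟩ := exists_isChord hθ hΩ hb hs
  exact mem_biUnion (x := (α, β)) hchord hmem

theorem lintegral_slice_le {F G : ℝ → ℝ≥0∞}
    (h : ∀ α β, IsChord Ω θ y α β → ∫⁻ s in Ioo α β, F s ≤ ∫⁻ s in Ioo α β, G s) :
    ∫⁻ s in slice Ω θ y, F s ≤ ∫⁻ s in slice Ω θ y, G s := by
  simp only [slice_eq_iUnion_chords hθ hΩ hb,
    lintegral_biUnion countable_chords (fun _ _ => measurableSet_Ioo) pairwiseDisjoint_chords]
  exact ENNReal.tsum_le_tsum fun p => h _ _ p.2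

theorem integral_slice_eq_zero {E : Type*} [NormedAddCommGroup E] [NormedSpace ℝ E] {F : ℝ → E}
    (hF : IntegrableOn F (slice Ω θ y))
    (h : ∀ α β, IsChord Ω θ y α β → ∫ s in Ioo α β, F s = 0) :
    ∫ s in slice Ω θ y, F s = 0 := by
  have := (countable_chords (Ω := Ω) (y := y)).to_subtype
  rw [slice_eq_iUnion_chords hθ hΩ hb, biUnion_eq_iUnion] at hF ⊢
  rw [integral_iUnion (s := fun p : chords Ω θ y => Ioo p.1.1 p.1.2) (fun _ => measurableSet_Ioo)
    (fun p q hpq => pairwiseDisjoint_chords p.2 q.2 (Subtype.coe_injective.ne hpq)) hF]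
  exact (tsum_congr fun p : chords Ω θ y => h _ _ p.2).trans tsum_zero

end

end Chords

section WeakDerivativesOnLines

theorem exists_countable_isCompact_between (X : Type*) [TopologicalSpace X] [T2Space X]
    [LocallyCompactSpace X] [SecondCountableTopology X] :
    ∃ 𝒞 : Set (Set X), 𝒞.Countable ∧ (∀ C ∈ 𝒞, IsCompact C) ∧
      ∀ K U : Set X, IsCompact K → IsOpen U → K ⊆ U → ∃ C ∈ 𝒞, K ⊆ C ∧ C ⊆ U := by
  let 𝒞 : Set (Set X) := (fun F => closure (⋃₀ F)) ''
    {F | F.Finite ∧ F ⊆ TopologicalSpace.countableBasis X}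
  have hcount : 𝒞.Countable :=
    (countable_ofPred_finite_subset (TopologicalSpace.countable_countableBasis X)).image _
  refine ⟨{C ∈ 𝒞 | IsCompact C}, hcount.mono (sep_subset _ _), fun C hC => hC.2,
    fun K U hK hU hKU => ?_⟩
  obtain ⟨L, hL, hKL, hLU⟩ := exists_compact_between hK hU hKU
  obtain ⟨ℱ, hℱ, hLℱ⟩ := (TopologicalSpace.isBasis_countableBasis X).open_eq_sUnion
    (isOpen_interior (s := L))
  obtain ⟨F, hF, hFfin, hKF⟩ := hK.elim_finite_subcover_image
    (fun b hb => TopologicalSpace.isOpen_of_mem_countableBasis (hℱ hb))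
    (by rwa [← sUnion_eq_biUnion, ← hLℱ])
  rw [← sUnion_eq_biUnion] at hKF
  have hFL : closure (⋃₀ F) ⊆ L := closure_minimal
    ((sUnion_subset_sUnion hF).trans (hLℱ ▸ interior_subset)) hL.isClosed
  exact ⟨_, ⟨⟨F, ⟨hFfin, hF.trans hℱ⟩, rfl⟩, hL.of_isClosed_subset isClosed_closure hFL⟩,
    hKF.trans subset_closure, hFL.trans hLU⟩

theorem setIntegral_mul_eq_inner {X : Type*} [MeasurableSpace X] {μ : Measure X} {S : Set X}
    (hS : MeasurableSet S) {u p : X → ℝ} (hu : MemLp (S.indicator u) 2 μ) (hp : MemLp p 2 μ) :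
    ∫ x in S, u x * p x ∂μ = inner ℝ (hp.toLp p) (hu.toLp _) := by
  rw [L2.inner_def, ← integral_indicator hS]
  refine integral_congr_ae ?_
  filter_upwards [hu.coeFn_toLp, hp.coeFn_toLp] with x hux hpx
  rw [hux, hpx]
  by_cases hx : x ∈ S <;> simp [hx]

theorem exists_countable_dense_isTestFunction (C : Set ℝ) :
    ∃ 𝒯 : Set (ℝ → ℝ), 𝒯.Countable ∧ (∀ χ ∈ 𝒯, IsTestFunction C χ) ∧
      ∀ {S : Set ℝ} {u w : ℝ → ℝ}, MeasurableSet S → MemLp u 2 (volume.restrict S) →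
        MemLp w 2 (volume.restrict S) →
        (∀ χ ∈ 𝒯, ∫ s in S, (u s * deriv χ s + w s * χ s) = 0) →
        ∀ ψ, IsTestFunction C ψ → ∫ s in S, (u s * deriv ψ s + w s * ψ s) = 0 := by
  let 𝒟 := {ψ : ℝ → ℝ // IsTestFunction C ψ}
  have hmem : ∀ ψ : 𝒟, MemLp ψ.1 2 volume := fun ψ =>
    ψ.2.smooth.continuous.memLp_of_hasCompactSupport ψ.2.compact
  have hmem' : ∀ ψ : 𝒟, MemLp (deriv ψ.1) 2 volume := fun ψ =>
    (ψ.2.smooth.continuous_deriv (by simp)).memLp_of_hasCompactSupport ψ.2.compact.deriv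
  let ι : 𝒟 → Lp ℝ 2 (volume : Measure ℝ) × Lp ℝ 2 (volume : Measure ℝ) := fun ψ =>
    ((hmem' ψ).toLp _, (hmem ψ).toLp _)
  have : Fact ((2 : ℝ≥0∞) ≠ ⊤) := ⟨by norm_num⟩
  have : SecondCountableTopology (Lp ℝ 2 (volume : Measure ℝ)) :=
    UniformSpace.secondCountable_of_separable _
  let _ : TopologicalSpace 𝒟 := .induced ι inferInstance
  have : SecondCountableTopology 𝒟 := TopologicalSpace.secondCountableTopology_induced _ _ ι
  have hι : Continuous ι := continuous_induced_dom
  obtain ⟨t, htc, htd⟩ := TopologicalSpace.exists_countable_dense 𝒟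
  refine ⟨Subtype.val '' t, htc.image _, by rintro _ ⟨χ, -, rfl⟩; exact χ.2,
    fun {S u w} hS hu hw hzero ψ hψ => ?_⟩
  have hu' := (memLp_indicator_iff_restrict hS).2 hu
  have hw' := (memLp_indicator_iff_restrict hS).2 hw
  have hpairing : ∀ χ : 𝒟, ∫ s in S, (u s * deriv χ.1 s + w s * χ.1 s)
      = inner ℝ (ι χ).1 (hu'.toLp _) + inner ℝ (ι χ).2 (hw'.toLp _) := fun χ => by
    rw [← setIntegral_mul_eq_inner hS hu' (hmem' χ), ← setIntegral_mul_eq_inner hS hw' (hmem χ)]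
    exact integral_add (hu.integrable_mul ((hmem' χ).restrict S))
      (hw.integrable_mul ((hmem χ).restrict S))
  have hcont : Continuous fun χ : 𝒟 => ∫ s in S, (u s * deriv χ.1 s + w s * χ.1 s) := by
    simp only [hpairing]
    fun_prop
  exact congrFun (hcont.ext_on htd continuous_const fun χ hχ =>
    hzero _ (mem_image_of_mem _ hχ)) ⟨ψ, hψ⟩

variable {d : ℕ} {θ : Euc d} {Ω : Set (Euc d)} {C : Set ℝ} {u w : Euc d → ℝ} {η : Hyp θ → ℝ}
  {ψ : ℝ → ℝ}

theorem isOpen_setOf_subset_slice (hΩ : IsOpen Ω) (θ : Euc d) (hC : IsCompact C) :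
    IsOpen {y : Hyp θ | C ⊆ slice Ω θ y} :=
  isOpen_iff_mem_nhds.2 fun _ hy => hC.eventually_forall_of_forall_eventually fun _ ht =>
    (continuous_uncurry_line θ).continuousAt.eventually_mem (hΩ.mem_nhds (hy ht))

/-- The function on `ℝ^d` that is the product of a function `η` on `H_θ` and of a function `ψ` of
the coordinate along `θ`: the test functions that separate the lines of direction `θ`. -/
def prodFun (θ : Euc d) (η : Hyp θ → ℝ) (ψ : ℝ → ℝ) (x : Euc d) : ℝ :=
  η ((Hyp θ).orthogonalProjectionOnto x) * ψ (inner ℝ θ x)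

theorem prodFun_line (hθ : ‖θ‖ = 1) (η : Hyp θ → ℝ) (ψ : ℝ → ℝ) (y : Hyp θ) (s : ℝ) :
    prodFun θ η ψ (line θ y s) = η y * ψ s := by
  rw [prodFun, orthogonalProjectionOnto_line, inner_line hθ]

theorem contDiff_prodFun (hη : ContDiff ℝ ∞ η) (hψ : ContDiff ℝ ∞ ψ) :
    ContDiff ℝ ∞ (prodFun θ η ψ) :=
  (hη.comp (Hyp θ).orthogonalProjectionOnto.contDiff).mul
    (hψ.comp (contDiff_const.inner ℝ contDiff_id))

theorem isTestFunction_prodFun (hθ : ‖θ‖ = 1)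
    (hη : IsTestFunction {y : Hyp θ | C ⊆ slice Ω θ y} η) (hψ : IsTestFunction C ψ) :
    IsTestFunction Ω (prodFun θ η ψ) := by
  have hK : IsCompact (Function.uncurry (line θ) '' (tsupport η ×ˢ tsupport ψ)) :=
    (hη.compact.prod hψ.compact).image (continuous_uncurry_line θ)
  have hsub : tsupport (prodFun θ η ψ)
      ⊆ Function.uncurry (line θ) '' (tsupport η ×ˢ tsupport ψ) := by
    refine closure_minimal (fun x hx => ?_) hK.isClosed
    obtain ⟨y, s, rfl⟩ := exists_line_eq hθ x
    rw [Function.mem_support, prodFun_line hθ] at hx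
    exact ⟨(y, s), ⟨subset_tsupport _ (left_ne_zero_of_mul hx),
      subset_tsupport _ (right_ne_zero_of_mul hx)⟩, rfl⟩
  refine ⟨contDiff_prodFun hη.smooth hψ.smooth, hK.of_isClosed_subset (isClosed_tsupport _) hsub,
    hsub.trans ?_⟩
  rintro _ ⟨⟨y, s⟩, ⟨hy, hs⟩, rfl⟩
  exact hη.supp hy (hψ.supp hs)

theorem hasDerivAt_line (θ : Euc d) (y : Hyp θ) (s : ℝ) : HasDerivAt (line θ y) θ s := by
  unfold line
  simpa only [id, one_smul] using ((hasDerivAt_id s).smul_const θ).add_const (y : Euc d)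

theorem fderiv_prodFun_line (hθ : ‖θ‖ = 1) (hη : ContDiff ℝ ∞ η) (hψ : ContDiff ℝ ∞ ψ)
    (y : Hyp θ) (s : ℝ) : fderiv ℝ (prodFun θ η ψ) (line θ y s) θ = η y * deriv ψ s := by
  have hchain := ((contDiff_prodFun hη hψ).differentiable (by simp)
    (line θ y s)).hasFDerivAt.comp_hasDerivAt s (hasDerivAt_line θ y s)
  have hline : prodFun θ η ψ ∘ line θ y = fun s => η y * ψ s :=
    funext fun s => prodFun_line hθ η ψ y s
  rw [hline] at hchain
  exact hchain.unique ((hψ.differentiable (by simp) s).hasDerivAt.const_mul (η y))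

theorem integral_smul_integral_slice_eq_zero (hθ : ‖θ‖ = 1) (hΩ : IsOpen Ω)
    (hu : MemLp u 2 (volume.restrict Ω)) (hw : MemLp w 2 (volume.restrict Ω))
    (h : IsWeakDirDeriv Ω θ u w) (hη : IsTestFunction {y : Hyp θ | C ⊆ slice Ω θ y} η)
    (hψ : IsTestFunction C ψ) :
    ∫ y, η y • (∫ s in slice Ω θ y, (u (line θ y s) * deriv ψ s + w (line θ y s) * ψ s))
      ∂(hypVolume θ) = 0 := by
  have hφ := isTestFunction_prodFun hθ hη hψ
  have hint : IntegrableOn (fun x => u x * fderiv ℝ (prodFun θ η ψ) x θ) Ω :=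
    hu.integrable_mul (hφ.memLp_fderiv θ)
  have hint' : IntegrableOn (fun x => w x * prodFun θ η ψ x) Ω := hw.integrable_mul hφ.memLp
  have hlines := integral_lines hθ hΩ.measurableSet (hint.add hint')
  simp only [Pi.add_apply] at hlines
  rw [integral_add hint hint', h _ hφ, neg_add_cancel] at hlines
  rw [hlines]
  refine integral_congr_ae (Eventually.of_forall fun y => ?_)
  simp only [fderiv_prodFun_line hθ hη.smooth hψ.smooth, prodFun_line hθ, smul_eq_mul,
    ← integral_const_mul]
  congr 1 with s
  ring

theorem integrable_integral_slice [IsFiniteMeasure (volume.restrict Ω)] (hθ : ‖θ‖ = 1)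
    (hΩ : IsOpen Ω) (hu : MemLp u 2 (volume.restrict Ω)) (hw : MemLp w 2 (volume.restrict Ω))
    (hψ : IsTestFunction C ψ) :
    Integrable (fun y => ∫ s in slice Ω θ y,
      (u (line θ y s) * deriv ψ s + w (line θ y s) * ψ s)) (hypVolume θ) := by
  have hmul : ∀ {v : Euc d → ℝ} {χ : ℝ → ℝ}, MemLp v 2 (volume.restrict Ω) → Continuous χ →
      HasCompactSupport χ → IntegrableOn (fun x => v x * χ (inner ℝ θ x)) Ω := by
    intro v χ hv hχ hχc
    obtain ⟨M, hM⟩ := hχc.exists_bound_of_continuous hχ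
    exact (hv.integrable (by norm_num)).mul_bdd
      (hχ.comp (by fun_prop : Continuous fun x => inner ℝ θ x)).aestronglyMeasurable
      (Eventually.of_forall fun x => hM _)
  have hlines := integrable_integral_lines hθ hΩ.measurableSet
    ((hmul hu (hψ.smooth.continuous_deriv (by simp)) hψ.compact.deriv).add
      (hmul hw hψ.smooth.continuous hψ.compact))
  simpa only [Pi.add_apply, inner_line hθ] using hlines

theorem ae_integral_slice_eq_zero [IsFiniteMeasure (volume.restrict Ω)] (hθ : ‖θ‖ = 1)
    (hΩ : IsOpen Ω) (hu : MemLp u 2 (volume.restrict Ω)) (hw : MemLp w 2 (volume.restrict Ω))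
    (h : IsWeakDirDeriv Ω θ u w) (hC : IsCompact C) (hψ : IsTestFunction C ψ) :
    ∀ᵐ y ∂(hypVolume θ), C ⊆ slice Ω θ y →
      ∫ s in slice Ω θ y, (u (line θ y s) * deriv ψ s + w (line θ y s) * ψ s) = 0 :=
  (isOpen_setOf_subset_slice hΩ θ hC).ae_eq_zero_of_integral_contDiff_smul_eq_zero
    ((integrable_integral_slice hθ hΩ hu hw hψ).locallyIntegrable.locallyIntegrableOn _)
    fun _ hη hηc hηs => integral_smul_integral_slice_eq_zero hθ hΩ hu hw h ⟨hη, hηc, hηs⟩ hψ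

theorem ae_isWeakDirDeriv_slice [IsFiniteMeasure (volume.restrict Ω)] (hθ : ‖θ‖ = 1)
    (hΩ : IsOpen Ω) (hu : MemLp u 2 (volume.restrict Ω)) (hw : MemLp w 2 (volume.restrict Ω))
    (h : IsWeakDirDeriv Ω θ u w) :
    ∀ᵐ y ∂(hypVolume θ),
      IsWeakDirDeriv (slice Ω θ y) (1 : ℝ) (u ∘ line θ y) (w ∘ line θ y) := by
  obtain ⟨𝒞, h𝒞, hcomp, hcofinal⟩ := exists_countable_isCompact_between ℝ
  choose 𝒯 h𝒯 htest hdense using exists_countable_dense_isTestFunction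
  have hzero : ∀ᵐ y ∂(hypVolume θ), ∀ C ∈ 𝒞, ∀ χ ∈ 𝒯 C, C ⊆ slice Ω θ y →
      ∫ s in slice Ω θ y, (u (line θ y s) * deriv χ s + w (line θ y s) * χ s) = 0 :=
    (ae_ball_iff h𝒞).2 fun C hC => (ae_ball_iff (h𝒯 C)).2 fun χ hχ =>
      ae_integral_slice_eq_zero hθ hΩ hu hw h (hcomp C hC) (htest C χ hχ)
  have h2 : (2 : ℝ≥0∞) ≠ 0 := two_ne_zero
  have h2' : (2 : ℝ≥0∞) ≠ ⊤ := ENNReal.ofNat_ne_top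
  filter_upwards [hzero, memLp_lines hθ hΩ.measurableSet h2 h2' hu,
    memLp_lines hθ hΩ.measurableSet h2 h2' hw] with y hy huy hwy ψ hψ
  obtain ⟨C, hC, hψC, hCy⟩ := hcofinal _ _ hψ.compact (isOpen_slice hΩ y) hψ.supp
  have hint := hdense C (measurableSet_slice hΩ.measurableSet y) huy hwy
    (fun χ hχ => hy C hC χ hχ hCy) ψ ⟨hψ.smooth, hψ.compact, hψC⟩
  have hψ2 : MemLp ψ 2 volume := hψ.smooth.continuous.memLp_of_hasCompactSupport hψ.compact
  have hψ2' : MemLp (deriv ψ) 2 volume :=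
    (hψ.smooth.continuous_deriv (by simp)).memLp_of_hasCompactSupport hψ.compact.deriv
  simp only [fderiv_apply_one_eq_deriv]
  rw [← add_eq_zero_iff_eq_neg, ← hint]
  exact (integral_add (huy.integrable_mul (hψ2'.restrict _))
    (hwy.integrable_mul (hψ2.restrict _))).symm

end WeakDerivativesOnLines

section Squares

variable {X : Type*} [MeasurableSpace X] {μ : Measure X}

theorem eLpNorm_two_sq {F : Type*} [NormedAddCommGroup F] (f : X → F) :
    eLpNorm f 2 μ ^ 2 = ∫⁻ x, ‖f x‖ₑ ^ 2 ∂μ := by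
  simpa using eLpNorm_nnreal_pow_eq_lintegral (f := f) (μ := μ) (p := 2) two_ne_zero

theorem add_sq_le_two_mul (a b : ℝ≥0∞) : (a + b) ^ 2 ≤ 2 * (a ^ 2 + b ^ 2) := by
  have := ENNReal.rpow_add_le_mul_rpow_add_rpow a b one_le_two
  norm_num at this
  exact this

theorem sq_lintegral_le {f : X → ℝ≥0∞} (hf : AEMeasurable f μ) :
    (∫⁻ x, f x ∂μ) ^ 2 ≤ μ univ * ∫⁻ x, f x ^ 2 ∂μ := by
  have h := ENNReal.lintegral_mul_le_Lp_mul_Lq μ Real.HolderConjugate.two_two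
    (aemeasurable_const (b := (1 : ℝ≥0∞))) hf
  simp only [Pi.mul_apply, one_mul, one_pow, lintegral_const, ENNReal.rpow_two] at h
  calc (∫⁻ x, f x ∂μ) ^ 2 ≤ (μ univ ^ (1 / 2 : ℝ) * (∫⁻ x, f x ^ 2 ∂μ) ^ (1 / 2 : ℝ)) ^ 2 := by
        gcongr
    _ = μ univ * ∫⁻ x, f x ^ 2 ∂μ := by
        rw [← ENNReal.mul_rpow_of_nonneg _ _ (by norm_num), ← ENNReal.rpow_natCast,
          ← ENNReal.rpow_mul]
        norm_num

end Squares

section Interval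

theorem eqOn_Ioc_of_ae_Ioo {E : Type*} [TopologicalSpace E] [T2Space E] {α β : ℝ} {f g : ℝ → E}
    (hf : ContinuousOn f (Ioc α β)) (hg : ContinuousOn g (Ioc α β))
    (h : ∀ᵐ s ∂(volume.restrict (Ioo α β)), f s = g s) : EqOn f g (Ioc α β) := by
  refine Measure.eqOn_Ioc_of_ae_eq (μ := volume) ?_ hf hg
  rwa [Measure.restrict_congr_set Ioo_ae_eq_Ioc.symm]

variable {E : Type*} [NormedAddCommGroup E] [NormedSpace ℝ E] {α β : ℝ}

theorem enorm_sq_le_of_eq_add_integral {w : ℝ → E} {a b : E} {s : ℝ} (hs : s ∈ Ioo α β)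
    (hw : IntegrableOn w (Ioo α β)) (h : b = a + ∫ t in s..β, w t) :
    ‖b‖ₑ ^ 2 ≤ 2 * (‖a‖ₑ ^ 2 + ENNReal.ofReal (β - α) * ∫⁻ t in Ioo α β, ‖w t‖ₑ ^ 2) := by
  have hint : ‖∫ t in s..β, w t‖ₑ ≤ ∫⁻ t in Ioo α β, ‖w t‖ₑ := by
    rw [intervalIntegral.integral_of_le hs.2.le, integral_Ioc_eq_integral_Ioo]
    exact (enorm_integral_le_lintegral_enorm _).trans
      (lintegral_mono_set (Ioo_subset_Ioo_left hs.1.le))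
  have hsq := sq_lintegral_le hw.1.enorm
  rw [Measure.restrict_apply_univ, Real.volume_Ioo] at hsq
  calc ‖b‖ₑ ^ 2 ≤ (‖a‖ₑ + ∫⁻ t in Ioo α β, ‖w t‖ₑ) ^ 2 := by
        rw [h]
        gcongr
        exact (enorm_add_le _ _).trans (by gcongr)
    _ ≤ 2 * (‖a‖ₑ ^ 2 + (∫⁻ t in Ioo α β, ‖w t‖ₑ) ^ 2) := add_sq_le_two_mul _ _
    _ ≤ _ := by gcongr

theorem enorm_sq_mul_le_of_ae_eq_add_integral {v w : ℝ → E} {b : E}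
    (hv : AEStronglyMeasurable v (volume.restrict (Ioo α β))) (hw : IntegrableOn w (Ioo α β))
    (h : ∀ᵐ s ∂(volume.restrict (Ioo α β)), b = v s + ∫ t in s..β, w t) :
    ‖b‖ₑ ^ 2 * ENNReal.ofReal (β - α) ≤ 2 * (∫⁻ s in Ioo α β, ‖v s‖ₑ ^ 2)
      + 2 * ENNReal.ofReal (β - α) ^ 2 * ∫⁻ s in Ioo α β, ‖w s‖ₑ ^ 2 := by
  calc ‖b‖ₑ ^ 2 * ENNReal.ofReal (β - α) = ∫⁻ _ in Ioo α β, ‖b‖ₑ ^ 2 := by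
        rw [setLIntegral_const, Real.volume_Ioo]
    _ ≤ ∫⁻ s in Ioo α β,
          2 * (‖v s‖ₑ ^ 2 + ENNReal.ofReal (β - α) * ∫⁻ t in Ioo α β, ‖w t‖ₑ ^ 2) := by
        refine lintegral_mono_ae ?_
        filter_upwards [h, ae_restrict_mem measurableSet_Ioo] with s hs hmem
        exact enorm_sq_le_of_eq_add_integral hmem hw hs
    _ = _ := by
        rw [lintegral_const_mul' _ _ (by norm_num), lintegral_add_left' (hv.enorm.pow_const 2),
          setLIntegral_const, Real.volume_Ioo]
        ring

end Interval

section GoodLines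

variable {d : ℕ} {θ : Euc d} {Ω : Set (Euc d)} {α β R : ℝ}

/-- A function representing the gradient of `u ∈ H¹(Ω)`. -/
def H1grad (u : H1 Ω) : Euc d → Euc d := u.1.snd

theorem memLp_H1rep (u : H1 Ω) : MemLp (H1rep u) 2 (volume.restrict Ω) := Lp.memLp _

theorem memLp_H1grad (u : H1 Ω) : MemLp (H1grad u) 2 (volume.restrict Ω) := Lp.memLp _

theorem H1rep_sub (u v : H1 Ω) :
    H1rep (u - v) =ᵐ[volume.restrict Ω] fun x => H1rep u x - H1rep v x :=
  Lp.coeFn_sub u.1.fst v.1.fst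

theorem H1grad_sub (u v : H1 Ω) :
    H1grad (u - v) =ᵐ[volume.restrict Ω] fun x => H1grad u x - H1grad v x :=
  Lp.coeFn_sub u.1.snd v.1.snd

/-- The energy density `|u|² + |∇u|²`, whose integral is the squared norm of `H¹(Ω)`. -/
def energy (u : H1 Ω) (x : Euc d) : ℝ≥0∞ := ‖H1rep u x‖ₑ ^ 2 + ‖H1grad u x‖ₑ ^ 2

theorem aemeasurable_energy (u : H1 Ω) : AEMeasurable (energy u) (volume.restrict Ω) :=
  ((memLp_H1rep u).1.enorm.pow_const 2).add ((memLp_H1grad u).1.enorm.pow_const 2)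

theorem enorm_sq_eq (u : H1 Ω) : ‖u‖ₑ ^ 2 = ‖u.1.fst‖ₑ ^ 2 + ‖u.1.snd‖ₑ ^ 2 := by
  have h : ‖u‖ ^ 2 = ‖u.1.fst‖ ^ 2 + ‖u.1.snd‖ ^ 2 := WithLp.prod_norm_sq_eq_of_L2 u.1
  simp only [← ofReal_norm, ← ENNReal.ofReal_pow (norm_nonneg _), h,
    ENNReal.ofReal_add (sq_nonneg _) (sq_nonneg _)]

theorem lintegral_energy (u : H1 Ω) : ∫⁻ x in Ω, energy u x = ‖u‖ₑ ^ 2 := by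
  rw [enorm_sq_eq, Lp.enorm_def, Lp.enorm_def, eLpNorm_two_sq, eLpNorm_two_sq]
  exact lintegral_add_left' ((memLp_H1rep u).1.enorm.pow_const 2) _

/-- The derivative along `θ` of `u ∈ H¹(Ω)` on the line `y + ℝθ`. -/
def lineDerivRep (u : H1 Ω) (θ : Euc d) (y : Hyp θ) (s : ℝ) : ℝ :=
  inner ℝ (H1grad u (line θ y s)) θ

/-- The restriction of `u ∈ H¹(Ω)` to the line `y + ℝθ` is in `H¹(ω_θ(y))`, its derivative being
given by the gradient of `u`. -/
structure IsGoodLine (u : H1 Ω) (θ : Euc d) (y : Hyp θ) : Prop where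
  memLp : MemLp (H1rep u ∘ line θ y) 2 (volume.restrict (slice Ω θ y))
  memLp_grad : MemLp (H1grad u ∘ line θ y) 2 (volume.restrict (slice Ω θ y))
  weakDeriv : IsWeakDirDeriv (slice Ω θ y) (1 : ℝ) (H1rep u ∘ line θ y) (lineDerivRep u θ y)

theorem ae_isGoodLine (hθ : ‖θ‖ = 1) (hΩ : IsOpen Ω) (hb : Bornology.IsBounded Ω) (u : H1 Ω) :
    ∀ᵐ y : Hyp θ ∂(hypVolume θ), IsGoodLine u θ y := by
  have : IsFiniteMeasure (volume.restrict Ω) := ⟨by simpa using hb.measure_lt_top⟩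
  have h2 : (2 : ℝ≥0∞) ≠ ⊤ := ENNReal.ofNat_ne_top
  filter_upwards [memLp_lines hθ hΩ.measurableSet two_ne_zero h2 (memLp_H1rep u),
    memLp_lines hθ hΩ.measurableSet two_ne_zero h2 (memLp_H1grad u),
    ae_isWeakDirDeriv_slice hθ hΩ (memLp_H1rep u) ((memLp_H1grad u).inner_const θ) (u.2 θ)]
    with y hrep hgrad hderiv
  exact ⟨hrep, hgrad, hderiv⟩

/-- `f` is the continuous representative of `u` on the chord `]α, β]`. -/
def IsChordRep (u : Euc d → ℝ) (θ : Euc d) (y : Hyp θ) (α β : ℝ) (f : ℝ → ℝ) : Prop :=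
  ContinuousOn f (Ioc α β) ∧ ∀ᵐ s ∂(volume.restrict (Ioo α β)), f s = u (line θ y s)

/-- The constant of the trace inequality on a domain contained in a ball of radius `R`. -/
def traceConst (R : ℝ) : ℝ≥0∞ := 2 * (1 + ENNReal.ofReal (2 * R))

theorem traceConst_ne_top (R : ℝ) : traceConst R ≠ ⊤ := by
  unfold traceConst; finiteness

theorem two_le_traceConst_sq (R : ℝ) : 2 ≤ traceConst R ^ 2 := by
  calc (2 : ℝ≥0∞) ≤ 2 + (2 + 8 * ENNReal.ofReal (2 * R) + 4 * ENNReal.ofReal (2 * R) ^ 2) :=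
        le_self_add
    _ = traceConst R ^ 2 := by unfold traceConst; ring

theorem two_mul_sq_le_traceConst_sq (R : ℝ) :
    2 * ENNReal.ofReal (2 * R) ^ 2 ≤ traceConst R ^ 2 := by
  calc 2 * ENNReal.ofReal (2 * R) ^ 2
      ≤ 2 * ENNReal.ofReal (2 * R) ^ 2
        + (4 + 8 * ENNReal.ofReal (2 * R) + 2 * ENNReal.ofReal (2 * R) ^ 2) := le_self_add
    _ = traceConst R ^ 2 := by unfold traceConst; ring

namespace IsGoodLine

variable {u : H1 Ω} {y : Hyp θ} {f : ℝ → ℝ}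

theorem memLp_chord (h : IsGoodLine u θ y) (hc : IsChord Ω θ y α β) :
    MemLp (H1rep u ∘ line θ y) 2 (volume.restrict (Ioo α β)) :=
  h.memLp.mono_measure (Measure.restrict_mono_set _ hc.2.1)

theorem memLp_lineDerivRep (h : IsGoodLine u θ y) :
    MemLp (lineDerivRep u θ y) 2 (volume.restrict (slice Ω θ y)) :=
  h.memLp_grad.inner_const θ

theorem integrableOn_lineDerivRep (h : IsGoodLine u θ y) (hc : IsChord Ω θ y α β) :
    IntegrableOn (lineDerivRep u θ y) (Ioo α β) :=
  (h.memLp_lineDerivRep.mono_measure (Measure.restrict_mono_set _ hc.2.1)).integrable one_le_two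

theorem intervalIntegrable_lineDerivRep (h : IsGoodLine u θ y) (hc : IsChord Ω θ y α β) :
    IntervalIntegrable (lineDerivRep u θ y) volume α β :=
  (intervalIntegrable_iff_integrableOn_Ioo_of_le hc.1.le).2 (h.integrableOn_lineDerivRep hc)

theorem exists_isChordRep_primitive (h : IsGoodLine u θ y) (hΩ : IsOpen Ω)
    (hc : IsChord Ω θ y α β) : ∃ c, IsChordRep (H1rep u) θ y α β
      fun s => c + ∫ t in α..s, lineDerivRep u θ y t := by
  obtain ⟨c, hcs⟩ := exists_ae_eq_primitive hc.1 ((h.memLp_chord hc).integrable one_le_two)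
    (h.integrableOn_lineDerivRep hc) (h.weakDeriv.mono (isOpen_slice hΩ y) hc.2.1)
  refine ⟨c, ?_, hcs.mono fun s hs => hs.symm⟩
  have hac := absolutelyContinuousOnInterval_primitive (h.intervalIntegrable_lineDerivRep hc) c
  exact hac.continuousOn.mono (by rw [uIcc_of_le hc.1.le]; exact Ioc_subset_Icc_self)

theorem exists_eqOn_primitive (h : IsGoodLine u θ y) (hΩ : IsOpen Ω) (hc : IsChord Ω θ y α β)
    (hf : IsChordRep (H1rep u) θ y α β f) :
    ∃ c, EqOn f (fun s => c + ∫ t in α..s, lineDerivRep u θ y t) (Ioc α β) := by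
  obtain ⟨c, hcont, hae⟩ := h.exists_isChordRep_primitive hΩ hc
  refine ⟨c, eqOn_Ioc_of_ae_Ioo hf.1 hcont ?_⟩
  filter_upwards [hf.2, hae] with s h1 h2 using h1.trans h2.symm

theorem ae_eq_add_integral (h : IsGoodLine u θ y) (hΩ : IsOpen Ω) (hc : IsChord Ω θ y α β)
    (hf : IsChordRep (H1rep u) θ y α β f) :
    ∀ᵐ s ∂(volume.restrict (Ioo α β)),
      f β = H1rep u (line θ y s) + ∫ t in s..β, lineDerivRep u θ y t := by
  obtain ⟨c, hfc⟩ := h.exists_eqOn_primitive hΩ hc hf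
  have hw := h.intervalIntegrable_lineDerivRep hc
  filter_upwards [hf.2, ae_restrict_mem measurableSet_Ioo] with s hs hmem
  have hsub : s ∈ uIcc α β := by rw [uIcc_of_le hc.1.le]; exact Ioo_subset_Icc_self hmem
  rw [← hs, hfc (right_mem_Ioc.2 hc.1), hfc (Ioo_subset_Ioc_self hmem)]
  simp only [add_assoc]
  rw [intervalIntegral.integral_add_adjacent_intervals
    (hw.mono_set (uIcc_subset_uIcc_left hsub)) (hw.mono_set (uIcc_subset_uIcc_right hsub))]

theorem lintegral_lineDerivRep_le (hθ : ‖θ‖ = 1) (u : H1 Ω) (y : Hyp θ) (s : Set ℝ) :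
    ∫⁻ t in s, ‖lineDerivRep u θ y t‖ₑ ^ 2 ≤ ∫⁻ t in s, ‖H1grad u (line θ y t)‖ₑ ^ 2 := by
  refine lintegral_mono fun t => ?_
  have h : ‖lineDerivRep u θ y t‖ ≤ ‖H1grad u (line θ y t)‖ := by
    simpa [hθ, lineDerivRep] using norm_inner_le_norm (𝕜 := ℝ) (H1grad u (line θ y t)) θ
  exact pow_le_pow_left' (enorm_le_iff_norm_le.2 h) 2

theorem trace_le (h : IsGoodLine u θ y) (hθ : ‖θ‖ = 1) (hΩ : IsOpen Ω)
    (hR : Ω ⊆ Metric.closedBall 0 R) (hc : IsChord Ω θ y α β)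
    (hf : IsChordRep (H1rep u) θ y α β f) :
    ‖f β‖ₑ ^ 2 * ENNReal.ofReal (β - α)
      ≤ traceConst R ^ 2 * ∫⁻ s in Ioo α β, energy u (line θ y s) := by
  have hv := (h.memLp_chord hc).1
  have hL : 2 * ENNReal.ofReal (β - α) ^ 2 ≤ traceConst R ^ 2 :=
    le_trans (by gcongr; exact hc.sub_le hθ hR) (two_mul_sq_le_traceConst_sq R)
  calc ‖f β‖ₑ ^ 2 * ENNReal.ofReal (β - α)
      ≤ 2 * (∫⁻ s in Ioo α β, ‖H1rep u (line θ y s)‖ₑ ^ 2)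
        + 2 * ENNReal.ofReal (β - α) ^ 2 * ∫⁻ s in Ioo α β, ‖lineDerivRep u θ y s‖ₑ ^ 2 :=
        enorm_sq_mul_le_of_ae_eq_add_integral hv (h.integrableOn_lineDerivRep hc)
          (h.ae_eq_add_integral hΩ hc hf)
    _ ≤ traceConst R ^ 2 * (∫⁻ s in Ioo α β, ‖H1rep u (line θ y s)‖ₑ ^ 2)
        + traceConst R ^ 2 * ∫⁻ s in Ioo α β, ‖H1grad u (line θ y s)‖ₑ ^ 2 :=
        add_le_add (mul_le_mul_left (two_le_traceConst_sq R) _)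
          (mul_le_mul' hL (lintegral_lineDerivRep_le hθ u y _))
    _ = traceConst R ^ 2 * ∫⁻ s in Ioo α β, energy u (line θ y s) := by
        rw [← mul_add, ← lintegral_add_left' (f := fun s => ‖H1rep u (line θ y s)‖ₑ ^ 2)
          (hv.enorm.pow_const 2)]
        rfl

end IsGoodLine

end GoodLines

section DirectionalTraces

variable {d : ℕ} {θ : Euc d} {Ω : Set (Euc d)} {α β R : ℝ}

/-- On almost every line of direction `θ`, `g` gives the values at the right ends of the chords of
the continuous representative of `u`. In contrast with `IsDirTrace`, it refers to `u` itself and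
not to a representative of its class. -/
def HasLineTraces (Ω : Set (Euc d)) (θ : Euc d) (u g : Euc d → ℝ) : Prop :=
  ∀ᵐ y : Hyp θ ∂(hypVolume θ), ∀ α β, IsChord Ω θ y α β →
    ∃ f, IsChordRep u θ y α β f ∧ g (line θ y β) = f β

theorem IsChordRep.congr {u v : Euc d → ℝ} {y : Hyp θ} {f : ℝ → ℝ}
    (hf : IsChordRep u θ y α β f)
    (h : ∀ᵐ s ∂(volume.restrict (Ioo α β)), u (line θ y s) = v (line θ y s)) :
    IsChordRep v θ y α β f := by
  refine ⟨hf.1, ?_⟩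
  filter_upwards [hf.2, h] with s h1 h2 using h1.trans h2

theorem IsChordRep.sub {u v : Euc d → ℝ} {y : Hyp θ} {f g : ℝ → ℝ}
    (hf : IsChordRep u θ y α β f) (hg : IsChordRep v θ y α β g) :
    IsChordRep (u - v) θ y α β (f - g) := by
  refine ⟨hf.1.sub hg.1, ?_⟩
  filter_upwards [hf.2, hg.2] with s h1 h2
  rw [Pi.sub_apply, Pi.sub_apply, h1, h2]

theorem ae_chord_of_ae (hθ : ‖θ‖ = 1) (hΩ : MeasurableSet Ω) {P : Euc d → Prop}
    (h : ∀ᵐ x ∂(volume.restrict Ω), P x) :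
    ∀ᵐ y : Hyp θ ∂(hypVolume θ), ∀ α β, IsChord Ω θ y α β →
      ∀ᵐ s ∂(volume.restrict (Ioo α β)), P (line θ y s) :=
  (ae_lines hθ hΩ h).mono fun _ hy _ _ hc => ae_restrict_of_ae_restrict_of_subset hc.2.1 hy

theorem HasLineTraces.congr (hθ : ‖θ‖ = 1) (hΩ : MeasurableSet Ω) {u v g : Euc d → ℝ}
    (hg : HasLineTraces Ω θ u g) (h : u =ᵐ[volume.restrict Ω] v) : HasLineTraces Ω θ v g := by
  filter_upwards [hg, ae_chord_of_ae hθ hΩ h] with y hy huv α β hc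
  obtain ⟨f, hf, hfβ⟩ := hy α β hc
  exact ⟨f, hf.congr (huv α β hc), hfβ⟩

theorem HasLineTraces.sub {u v g h : Euc d → ℝ} (hg : HasLineTraces Ω θ u g)
    (hh : HasLineTraces Ω θ v h) : HasLineTraces Ω θ (u - v) (g - h) := by
  filter_upwards [hg, hh] with y hgy hhy α β hc
  obtain ⟨f₁, hf₁, e₁⟩ := hgy α β hc
  obtain ⟨f₂, hf₂, e₂⟩ := hhy α β hc
  exact ⟨f₁ - f₂, hf₁.sub hf₂, by simp only [Pi.sub_apply, e₁, e₂]⟩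

theorem HasLineTraces.H1rep_sub (hθ : ‖θ‖ = 1) (hΩ : MeasurableSet Ω) {u v : H1 Ω}
    {g h : Euc d → ℝ} (hg : HasLineTraces Ω θ (H1rep u) g)
    (hh : HasLineTraces Ω θ (H1rep v) h) : HasLineTraces Ω θ (H1rep (u - v)) (g - h) :=
  (hg.sub hh).congr hθ hΩ (OmniTrace.H1rep_sub u v).symm

theorem IsDirTrace.hasLineTraces (hθ : ‖θ‖ = 1) (hΩ : MeasurableSet Ω) {u g : Euc d → ℝ}
    (h : IsDirTrace Ω θ u g) : HasLineTraces Ω θ u g := by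
  obtain ⟨u', hu', A, -, hA0, hA⟩ := h
  have hu'g : HasLineTraces Ω θ u' g := by
    filter_upwards [measure_eq_zero_iff_ae_notMem.1 hA0] with y hyA α β hc
    obtain ⟨s, hs⟩ := nonempty_Ioo.2 hc.1
    have hy : y ∈ A := by_contra fun hn => hyA ⟨mem_projSet_of_mem_slice (hc.2.1 hs), hn⟩
    obtain ⟨f, hcont, hae, hfβ⟩ := (hA y hy).2 α β hc
    exact ⟨f, ⟨hcont, hae⟩, hfβ⟩
  exact hu'g.congr hθ hΩ hu'

theorem HasLineTraces.isDirTrace (hθ : ‖θ‖ = 1) (hΩ : IsOpen Ω) (hb : Bornology.IsBounded Ω)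
    {u : H1 Ω} {g : Euc d → ℝ} (h : HasLineTraces Ω θ (H1rep u) g) :
    IsDirTrace Ω θ (H1rep u) g := by
  refine ⟨H1rep u, ae_eq_refl _, projSet Ω θ ∩ {y | (∀ α β, IsChord Ω θ y α β →
    ∃ f, IsChordRep (H1rep u) θ y α β f ∧ g (line θ y β) = f β) ∧ IsGoodLine u θ y},
    inter_subset_left, ?_, ?_⟩
  · rw [measure_eq_zero_iff_ae_notMem]
    filter_upwards [h, ae_isGoodLine hθ hΩ hb u] with y hy hgood hn
    exact hn.2 ⟨hn.1, hy, hgood⟩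
  · rintro y ⟨-, hy, hgood⟩
    refine ⟨⟨hgood.memLp, _, hgood.memLp_lineDerivRep, hgood.weakDeriv⟩, fun α β hc => ?_⟩
    obtain ⟨f, hf, hfβ⟩ := hy α β hc
    exact ⟨f, hf.1, hf.2, hfβ⟩

theorem IsContRep.ae_isChordRep (hθ : ‖θ‖ = 1) (hΩ : IsOpen Ω) (hb : Bornology.IsBounded Ω)
    {u : H1 Ω} {f : Euc d → ℝ} (h : IsContRep u f) :
    ∀ᵐ y : Hyp θ ∂(hypVolume θ), ∀ α β, IsChord Ω θ y α β →
      IsChordRep (H1rep u) θ y α β (f ∘ line θ y) := by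
  filter_upwards [ae_chord_of_ae hθ hΩ.measurableSet h.2] with y hy α β hc
  refine ⟨h.1.comp (continuous_line y).continuousOn fun s hs => ?_,
    (hy α β hc).mono fun s hs => hs.symm⟩
  rcases eq_or_lt_of_le hs.2 with rfl | hlt
  · exact frontier_subset_closure (hc.mem_frontier hθ hΩ hb)
  · exact subset_closure (hc.2.1 ⟨hs.1, hlt⟩)

theorem IsContRep.hasLineTraces (hθ : ‖θ‖ = 1) (hΩ : IsOpen Ω) (hb : Bornology.IsBounded Ω)
    {u : H1 Ω} {f : Euc d → ℝ} (h : IsContRep u f) : HasLineTraces Ω θ (H1rep u) f :=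
  (h.ae_isChordRep hθ hΩ hb).mono fun _ hy α β hc => ⟨_, hy α β hc, rfl⟩

theorem ae_frontier_dirMeasure (hθ : ‖θ‖ = 1) (hΩ : IsOpen Ω) (hb : Bornology.IsBounded Ω) :
    ∀ᵐ z ∂(dirMeasure Ω θ), z ∈ frontier Ω :=
  dirMeasure_compl_frontier hΩ hb hθ

theorem IsContRep.aestronglyMeasurable (hθ : ‖θ‖ = 1) (hΩ : IsOpen Ω)
    (hb : Bornology.IsBounded Ω) {u : H1 Ω} {f : Euc d → ℝ} (h : IsContRep u f) :
    AEStronglyMeasurable f (dirMeasure Ω θ) := by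
  have hf := (h.1.mono frontier_subset_closure).aestronglyMeasurable (μ := dirMeasure Ω θ)
    isClosed_frontier.measurableSet
  rwa [Measure.restrict_eq_self_of_ae_mem (ae_frontier_dirMeasure hθ hΩ hb)] at hf

theorem IsGoodLine.lintegral_Phi_le (hθ : ‖θ‖ = 1) (hΩ : IsOpen Ω)
    (hR : Ω ⊆ Metric.closedBall 0 R) {u : H1 Ω} {y : Hyp θ} (hy : IsGoodLine u θ y)
    {g : Euc d → ℝ}
    (hg : ∀ α β, IsChord Ω θ y α β → ∃ f, IsChordRep (H1rep u) θ y α β f ∧ g (line θ y β) = f β) :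
    ∫⁻ s in slice Ω θ y, ‖g (Phi Ω θ (line θ y s))‖ₑ ^ 2
      ≤ ∫⁻ s in slice Ω θ y, traceConst R ^ 2 * energy u (line θ y s) := by
  have hb : Bornology.IsBounded Ω := Metric.isBounded_closedBall.subset hR
  refine lintegral_slice_le hθ hΩ hb fun α β hc => ?_
  obtain ⟨f, hf, hfβ⟩ := hg α β hc
  calc ∫⁻ s in Ioo α β, ‖g (Phi Ω θ (line θ y s))‖ₑ ^ 2
      = ∫⁻ _ in Ioo α β, ‖f β‖ₑ ^ 2 :=
        setLIntegral_congr_fun measurableSet_Ioo fun s hs => by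
          simp only [hc.Phi_eq hθ hb hs, hfβ]
    _ = ‖f β‖ₑ ^ 2 * ENNReal.ofReal (β - α) := by rw [setLIntegral_const, Real.volume_Ioo]
    _ ≤ traceConst R ^ 2 * ∫⁻ s in Ioo α β, energy u (line θ y s) := hy.trace_le hθ hΩ hR hc hf
    _ = ∫⁻ s in Ioo α β, traceConst R ^ 2 * energy u (line θ y s) :=
        (lintegral_const_mul' _ _ (ENNReal.pow_ne_top (traceConst_ne_top R))).symm

theorem HasLineTraces.eLpNorm_le (hθ : ‖θ‖ = 1) (hΩ : IsOpen Ω)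
    (hR : Ω ⊆ Metric.closedBall 0 R) {u : H1 Ω} {g : Euc d → ℝ}
    (hug : HasLineTraces Ω θ (H1rep u) g) (hg : AEStronglyMeasurable g (dirMeasure Ω θ)) :
    eLpNorm g 2 (dirMeasure Ω θ) ≤ traceConst R * ‖u‖ₑ := by
  have hb : Bornology.IsBounded Ω := Metric.isBounded_closedBall.subset hR
  have hΦ := aemeasurable_Phi (θ := θ) hΩ hb hθ
  have hm := hΩ.measurableSet
  rw [← ENNReal.pow_le_pow_left_iff two_ne_zero, mul_pow, eLpNorm_two_sq]
  calc ∫⁻ z, ‖g z‖ₑ ^ 2 ∂(dirMeasure Ω θ) = ∫⁻ x in Ω, ‖g (Phi Ω θ x)‖ₑ ^ 2 :=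
        lintegral_map' (hg.enorm.pow_const 2) hΦ
    _ = ∫⁻ y : Hyp θ, (∫⁻ s in slice Ω θ y, ‖g (Phi Ω θ (line θ y s))‖ₑ ^ 2) ∂(hypVolume θ) :=
        lintegral_lines hθ hm ((hg.comp_aemeasurable hΦ).enorm.pow_const 2)
    _ ≤ ∫⁻ y : Hyp θ, (∫⁻ s in slice Ω θ y, traceConst R ^ 2 * energy u (line θ y s))
          ∂(hypVolume θ) := by
        refine lintegral_mono_ae ?_
        filter_upwards [hug, ae_isGoodLine hθ hΩ hb u] with y hy hgood
          using hgood.lintegral_Phi_le hθ hΩ hR hy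
    _ = ∫⁻ x in Ω, traceConst R ^ 2 * energy u x :=
        (lintegral_lines hθ hm ((aemeasurable_energy u).const_mul _)).symm
    _ = traceConst R ^ 2 * ‖u‖ₑ ^ 2 := by
        rw [lintegral_const_mul' _ _ (ENNReal.pow_ne_top (traceConst_ne_top R)), lintegral_energy]

end DirectionalTraces

section OmnidirectionalTraces

variable {d : ℕ} {θ : Euc d} {Ω : Set (Euc d)} {R : ℝ} {g h : Euc d → ℝ}

theorem norm_eq_of_mem_sph (hθ : θ ∈ Sph d) : ‖θ‖ = 1 := mem_sphere_zero_iff_norm.1 hθ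

theorem enorm_zero_H1 : ‖(0 : H1 Ω)‖ₑ = 0 := by
  rw [← ofReal_norm, norm_zero, ENNReal.ofReal_zero]

theorem eLpNorm_le_bdryNorm (hθ : θ ∈ Sph d) (g : Euc d → ℝ) :
    eLpNorm g 2 (dirMeasure Ω θ) ≤ bdryNorm Ω g :=
  le_iSup₂ (f := fun θ (_ : θ ∈ Sph d) => eLpNorm g 2 (dirMeasure Ω θ)) θ hθ

theorem MemL2Bdry.aestronglyMeasurable (hg : MemL2Bdry Ω g) (hθ : θ ∈ Sph d) :
    AEStronglyMeasurable g (dirMeasure Ω θ) :=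
  let ⟨_, hM⟩ := hg
  (hM θ hθ).1.1

theorem MemL2Bdry.of_eLpNorm_le {C : ℝ≥0∞} (hC : C ≠ ⊤)
    (hm : ∀ θ ∈ Sph d, AEStronglyMeasurable g (dirMeasure Ω θ))
    (hg : ∀ θ ∈ Sph d, eLpNorm g 2 (dirMeasure Ω θ) ≤ C) : MemL2Bdry Ω g := by
  refine ⟨(C ^ 2).toReal, fun θ hθ =>
    ⟨⟨hm θ hθ, (hg θ hθ).trans_lt hC.lt_top⟩, ?_⟩⟩
  rw [integral_eq_lintegral_of_nonneg_ae (Eventually.of_forall fun z => sq_nonneg _)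
    ((hm θ hθ).pow 2)]
  refine ENNReal.toReal_mono (by finiteness) ?_
  calc ∫⁻ z, ENNReal.ofReal (g z ^ 2) ∂(dirMeasure Ω θ) = ∫⁻ z, ‖g z‖ₑ ^ 2 ∂(dirMeasure Ω θ) :=
        lintegral_congr fun z => by rw [← Real.enorm_of_nonneg (sq_nonneg _), enorm_pow]
    _ = eLpNorm g 2 (dirMeasure Ω θ) ^ 2 := (eLpNorm_two_sq g).symm
    _ ≤ C ^ 2 := by gcongr; exact hg θ hθ

theorem BdryEquiv.of_bdryNorm_eq_zero (hg : MemL2Bdry Ω g) (hh : MemL2Bdry Ω h)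
    (h0 : bdryNorm Ω (g - h) = 0) : BdryEquiv Ω g h := by
  intro θ hθ
  have hθ0 : eLpNorm (g - h) 2 (dirMeasure Ω θ) = 0 :=
    le_antisymm ((eLpNorm_le_bdryNorm hθ _).trans_eq h0) bot_le
  have hm := (hg.aestronglyMeasurable hθ).sub (hh.aestronglyMeasurable hθ)
  filter_upwards [(eLpNorm_eq_zero_iff hm two_ne_zero).1 hθ0] with z hz
  exact sub_eq_zero.1 hz

theorem bdryNorm_sub_le {f : Euc d → ℝ} (hf : MemL2Bdry Ω f) (hg : MemL2Bdry Ω g)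
    (hh : MemL2Bdry Ω h) : bdryNorm Ω (g - h) ≤ bdryNorm Ω (f - h) + bdryNorm Ω (f - g) := by
  refine iSup₂_le fun θ hθ => ?_
  have hfm := hf.aestronglyMeasurable hθ
  calc eLpNorm (g - h) 2 (dirMeasure Ω θ)
      = eLpNorm ((f - h) - (f - g)) 2 (dirMeasure Ω θ) := by rw [sub_sub_sub_cancel_left]
    _ ≤ eLpNorm (f - h) 2 (dirMeasure Ω θ) + eLpNorm (f - g) 2 (dirMeasure Ω θ) :=
        eLpNorm_sub_le (hfm.sub (hh.aestronglyMeasurable hθ))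
          (hfm.sub (hg.aestronglyMeasurable hθ)) one_le_two
    _ ≤ _ := add_le_add (eLpNorm_le_bdryNorm hθ _) (eLpNorm_le_bdryNorm hθ _)

theorem BdryEquiv.of_tendsto {f : ℕ → Euc d → ℝ} (hf : ∀ n, MemL2Bdry Ω (f n))
    (hg : MemL2Bdry Ω g) (hh : MemL2Bdry Ω h)
    (hfg : Tendsto (fun n => bdryNorm Ω (f n - g)) atTop (𝓝 0))
    (hfh : Tendsto (fun n => bdryNorm Ω (f n - h)) atTop (𝓝 0)) : BdryEquiv Ω g h := by
  refine BdryEquiv.of_bdryNorm_eq_zero hg hh (le_antisymm ?_ bot_le)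
  have hsum := hfh.add hfg
  rw [add_zero] at hsum
  exact ge_of_tendsto' hsum fun n => bdryNorm_sub_le (hf n) hg hh

theorem isOmniTrace_of_hasLineTraces (hΩ : IsOpen Ω) (hb : Bornology.IsBounded Ω) {u : H1 Ω}
    (hm : ∀ θ ∈ Sph d, AEStronglyMeasurable g (dirMeasure Ω θ))
    (hg : ∀ θ ∈ Sph d, HasLineTraces Ω θ (H1rep u) g) : IsOmniTrace u g := by
  obtain ⟨R, hR⟩ := hb.subset_closedBall 0
  exact ⟨.of_eLpNorm_le (ENNReal.mul_ne_top (traceConst_ne_top R) enorm_ne_top) hm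
      fun θ hθ => (hg θ hθ).eLpNorm_le (norm_eq_of_mem_sph hθ) hΩ hR (hm θ hθ),
    fun θ hθ => ⟨g, (hg θ hθ).isDirTrace (norm_eq_of_mem_sph hθ) hΩ hb, ae_eq_refl g⟩⟩

theorem IsContRep.isOmniTrace (hΩ : IsOpen Ω) (hb : Bornology.IsBounded Ω) {u : H1 Ω}
    (hg : IsContRep u g) : IsOmniTrace u g :=
  isOmniTrace_of_hasLineTraces hΩ hb
    (fun _ hθ => hg.aestronglyMeasurable (norm_eq_of_mem_sph hθ) hΩ hb)
    fun _ hθ => hg.hasLineTraces (norm_eq_of_mem_sph hθ) hΩ hb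

theorem IsOmniTrace.bdryNorm_sub_le (hΩ : IsOpen Ω) (hR : Ω ⊆ Metric.closedBall 0 R)
    {u v : H1 Ω} (hg : IsOmniTrace u g) (hh : IsOmniTrace v h) :
    bdryNorm Ω (g - h) ≤ traceConst R * ‖u - v‖ₑ := by
  refine iSup₂_le fun θ hθ => ?_
  have hθ₁ := norm_eq_of_mem_sph hθ
  obtain ⟨g', hg', hgg'⟩ := hg.2 θ hθ
  obtain ⟨h', hh', hhh'⟩ := hh.2 θ hθ
  have hm := ((hg.1.aestronglyMeasurable hθ).sub (hh.1.aestronglyMeasurable hθ)).congr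
    (hgg'.sub hhh').symm
  rw [← eLpNorm_congr_ae (hgg'.sub hhh')]
  exact ((hg'.hasLineTraces hθ₁ hΩ.measurableSet).H1rep_sub hθ₁ hΩ.measurableSet
    (hh'.hasLineTraces hθ₁ hΩ.measurableSet)).eLpNorm_le hθ₁ hΩ hR hm

theorem IsOmniTrace.bdryEquiv (hΩ : IsOpen Ω) (hb : Bornology.IsBounded Ω) {u : H1 Ω}
    (hg : IsOmniTrace u g) (hh : IsOmniTrace u h) : BdryEquiv Ω g h := by
  obtain ⟨R, hR⟩ := hb.subset_closedBall 0
  refine BdryEquiv.of_bdryNorm_eq_zero hg.1 hh.1 (le_antisymm ?_ bot_le)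
  simpa [enorm_zero_H1] using hg.bdryNorm_sub_le hΩ hR hh

theorem IsOmniTrace.tendsto_bdryNorm (hΩ : IsOpen Ω) (hb : Bornology.IsBounded Ω)
    {u : H1 Ω} (hg : IsOmniTrace u g) {v : ℕ → H1 Ω} {f : ℕ → Euc d → ℝ}
    (hf : ∀ n, IsOmniTrace (v n) (f n)) (hv : Tendsto v atTop (𝓝 u)) :
    Tendsto (fun n => bdryNorm Ω (f n - g)) atTop (𝓝 0) := by
  obtain ⟨R, hR⟩ := hb.subset_closedBall 0
  have hvu : Tendsto (fun n => ‖v n - u‖ₑ) atTop (𝓝 0) := by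
    simpa [enorm_zero_H1] using (tendsto_sub_nhds_zero_iff.2 hv).enorm
  have hC := ENNReal.Tendsto.const_mul hvu (Or.inr (traceConst_ne_top R))
  rw [mul_zero] at hC
  exact tendsto_of_tendsto_of_tendsto_of_le_of_le tendsto_const_nhds hC (fun _ => bot_le)
    fun n => (hf n).bdryNorm_sub_le hΩ hR hg

theorem tendsto_of_tendsto_enorm_sq {E : Type*} [SeminormedAddCommGroup E] {a : ℕ → E} {b : E}
    (h : Tendsto (fun n => ‖a n - b‖ₑ ^ 2) atTop (𝓝 0)) : Tendsto a atTop (𝓝 b) := by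
  have hroot := (ENNReal.continuous_rpow_const (y := (1 / 2 : ℝ))).tendsto 0 |>.comp h
  rw [ENNReal.zero_rpow_of_pos (by norm_num)] at hroot
  rw [tendsto_iff_edist_tendsto_0]
  refine hroot.congr fun n => ?_
  rw [Function.comp_apply, ← ENNReal.rpow_natCast, ← ENNReal.rpow_mul, edist_eq_enorm_sub]
  norm_num

theorem tendsto_of_enorm_sq_mul_le {E : Type*} [SeminormedAddCommGroup E] {a : ℕ → E} {b : E}
    {L C : ℝ≥0∞} {e : ℕ → ℝ≥0∞} (hL : L ≠ 0) (hL' : L ≠ ⊤) (hC : C ≠ ⊤)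
    (he : Tendsto e atTop (𝓝 0)) (h : ∀ n, ‖a n - b‖ₑ ^ 2 * L ≤ C * e n) :
    Tendsto a atTop (𝓝 b) := by
  have hlim : Tendsto (fun n => C * e n / L) atTop (𝓝 0) := by
    simpa using ENNReal.Tendsto.div_const (ENNReal.Tendsto.const_mul he (Or.inr hC)) (Or.inr hL)
  refine tendsto_of_tendsto_enorm_sq (tendsto_of_tendsto_of_tendsto_of_le_of_le
    tendsto_const_nhds hlim (fun _ => bot_le) fun n => ?_)
  exact (ENNReal.le_div_iff_mul_le (Or.inl hL) (Or.inl hL')).2 (h n)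

theorem exists_tsum_enorm_sq_ne_top_of_mem_H1tilde {u : H1 Ω} (hu : u ∈ H1tilde Ω) :
    ∃ (v : ℕ → H1 Ω) (f : ℕ → Euc d → ℝ), (∀ n, IsContRep (v n) (f n)) ∧
      ∑' n, ‖v n - u‖ₑ ^ 2 ≠ ⊤ := by
  obtain ⟨ε, hε, hεsum⟩ := ENNReal.exists_pos_sum_of_countable one_ne_zero ℕ
  have happrox : ∀ n, ∃ v : H1 Ω, (∃ f, IsContRep v f) ∧ ‖v - u‖ₑ ^ 2 < ε n := by
    intro n
    have ho : IsOpen {v : H1 Ω | ‖v - u‖ₑ ^ 2 < ε n} := isOpen_lt (by fun_prop) continuous_const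
    obtain ⟨v, hv₁, hv₂⟩ := mem_closure_iff.1 hu _ ho (by simp [enorm_zero_H1, hε n])
    exact ⟨v, hv₂, hv₁⟩
  choose v hv hvε using happrox
  choose f hf using hv
  exact ⟨v, f, hf, ne_top_of_lt ((ENNReal.tsum_le_tsum fun n => (hvε n).le).trans_lt hεsum)⟩

theorem ae_tsum_lintegral_energy_ne_top (hθ : ‖θ‖ = 1) (hΩ : MeasurableSet Ω) {v : ℕ → H1 Ω}
    (hv : ∑' n, ‖v n‖ₑ ^ 2 ≠ ⊤) : ∀ᵐ y : Hyp θ ∂(hypVolume θ),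
      ∑' n, ∫⁻ s in slice Ω θ y, energy (v n) (line θ y s) ≠ ⊤ := by
  have hm : ∀ n, AEMeasurable (fun y : Hyp θ =>
      ∫⁻ s in slice Ω θ y, energy (v n) (line θ y s)) (hypVolume θ) :=
    fun n => aemeasurable_lintegral_lines hθ hΩ (aemeasurable_energy _)
  refine (ae_lt_top' (AEMeasurable.tsum hm) ?_).mono fun y hy => hy.ne
  rw [lintegral_tsum hm]
  simpa only [← lintegral_lines hθ hΩ (aemeasurable_energy _), lintegral_energy] using hv

theorem ae_tendsto_right_end (hθ : ‖θ‖ = 1) (hΩ : IsOpen Ω) (hb : Bornology.IsBounded Ω)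
    {u : H1 Ω} {v : ℕ → H1 Ω} {f : ℕ → Euc d → ℝ} (hf : ∀ n, IsContRep (v n) (f n))
    (hv : ∑' n, ‖v n - u‖ₑ ^ 2 ≠ ⊤) : ∀ᵐ y : Hyp θ ∂(hypVolume θ), ∀ α β, IsChord Ω θ y α β →
      ∀ F, IsChordRep (H1rep u) θ y α β F →
        Tendsto (fun n => f n (line θ y β)) atTop (𝓝 (F β)) := by
  obtain ⟨R, hR⟩ := hb.subset_closedBall 0
  have hm := hΩ.measurableSet
  filter_upwards [ae_tsum_lintegral_energy_ne_top hθ hm hv,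
    ae_all_iff.2 fun n => ae_isGoodLine hθ hΩ hb (v n - u),
    ae_all_iff.2 fun n => (hf n).ae_isChordRep hθ hΩ hb,
    ae_all_iff.2 fun n => ae_chord_of_ae hθ hm (H1rep_sub (v n) u)]
    with y hsum hgood hrep hsub α β hc F hF
  refine tendsto_of_enorm_sq_mul_le (ENNReal.ofReal_pos.2 (sub_pos.2 hc.1)).ne'
    ENNReal.ofReal_ne_top (ENNReal.pow_ne_top (traceConst_ne_top R) (n := 2))
    (ENNReal.tendsto_atTop_zero_of_tsum_ne_top hsum) fun n => ?_
  have hrep_sub : IsChordRep (H1rep (v n - u)) θ y α β (f n ∘ line θ y - F) :=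
    ((hrep n α β hc).sub hF).congr ((hsub n α β hc).mono fun s hs => hs.symm)
  exact ((hgood n).trace_le hθ hΩ hR hc hrep_sub).trans (by gcongr; exact hc.2.1)

/-- The pointwise limit on `∂Ω` of a sequence of functions. The functions are cut off outside `∂Ω`
so that the limit is measurable as soon as they are continuous on `∂Ω`. -/
def bdryLim (Ω : Set (Euc d)) (f : ℕ → Euc d → ℝ) (z : Euc d) : ℝ :=
  limUnder atTop fun n => (frontier Ω).indicator (f n) z

theorem stronglyMeasurable_bdryLim {f : ℕ → Euc d → ℝ} (hf : ∀ n, ContinuousOn (f n) (frontier Ω)) :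
    StronglyMeasurable (bdryLim Ω f) := by
  classical
  refine StronglyMeasurable.limUnder fun n => Measurable.stronglyMeasurable ?_
  rw [← piecewise_eq_indicator]
  exact (hf n).measurable_piecewise continuousOn_const isClosed_frontier.measurableSet

theorem bdryLim_eq {f : ℕ → Euc d → ℝ} {z : Euc d} {a : ℝ} (hz : z ∈ frontier Ω)
    (h : Tendsto (fun n => f n z) atTop (𝓝 a)) : bdryLim Ω f z = a :=
  Tendsto.limUnder_eq (by simpa only [indicator_of_mem hz] using h)

theorem hasLineTraces_bdryLim (hθ : ‖θ‖ = 1) (hΩ : IsOpen Ω) (hb : Bornology.IsBounded Ω)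
    {u : H1 Ω} {v : ℕ → H1 Ω} {f : ℕ → Euc d → ℝ} (hf : ∀ n, IsContRep (v n) (f n))
    (hv : ∑' n, ‖v n - u‖ₑ ^ 2 ≠ ⊤) : HasLineTraces Ω θ (H1rep u) (bdryLim Ω f) := by
  filter_upwards [ae_isGoodLine hθ hΩ hb u, ae_tendsto_right_end hθ hΩ hb hf hv]
    with y hgood hlim α β hc
  obtain ⟨c, hF⟩ := hgood.exists_isChordRep_primitive hΩ hc
  exact ⟨_, hF, bdryLim_eq (hc.mem_frontier hθ hΩ hb) (hlim α β hc _ hF)⟩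

theorem exists_isOmniTrace (hΩ : IsOpen Ω) (hb : Bornology.IsBounded Ω) {u : H1 Ω}
    (hu : u ∈ H1tilde Ω) : ∃ g, IsOmniTrace u g := by
  obtain ⟨v, f, hf, hv⟩ := exists_tsum_enorm_sq_ne_top_of_mem_H1tilde hu
  have hm := stronglyMeasurable_bdryLim fun n => (hf n).1.mono frontier_subset_closure
  exact ⟨bdryLim Ω f, isOmniTrace_of_hasLineTraces hΩ hb (fun _ _ => hm.aestronglyMeasurable)
    fun θ hθ => hasLineTraces_bdryLim (norm_eq_of_mem_sph hθ) hΩ hb hf hv⟩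

theorem bdryNorm_eq_zero (hΩ : IsOpen Ω) (hb : Bornology.IsBounded Ω)
    (hg : ∀ z ∈ frontier Ω, g z = 0) : bdryNorm Ω g = 0 := by
  simp only [bdryNorm, ENNReal.iSup_eq_zero]
  intro θ hθ
  rw [eLpNorm_congr_ae (g := 0), eLpNorm_zero]
  filter_upwards [ae_frontier_dirMeasure (norm_eq_of_mem_sph hθ) hΩ hb] with z hz using hg z hz

theorem H10_subset_H1tr0 (hΩ : IsOpen Ω) (hb : Bornology.IsBounded Ω) : H10 Ω ⊆ H1tr0 Ω := by
  intro u hu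
  obtain ⟨v, hv, hvu⟩ := mem_closure_iff_seq_limit.1 hu
  choose φ hφ hφv using hv
  have hrep : ∀ n, IsContRep (v n) (φ n) := fun n =>
    ⟨(hφ n).smooth.continuous.continuousOn, hφv n⟩
  have htr : ∀ n, IsOmniTrace (v n) (φ n) := fun n => (hrep n).isOmniTrace hΩ hb
  obtain ⟨g, hg⟩ := exists_isOmniTrace hΩ hb (u := u)
    (mem_closure_iff_seq_limit.2 ⟨v, fun n => ⟨φ n, hrep n⟩, hvu⟩)
  have hzero : ∀ n, bdryNorm Ω (φ n - 0) = 0 := fun n =>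
    bdryNorm_eq_zero hΩ hb fun z hz => by
      rw [sub_zero, (hφ n).eq_zero_of_notMem (hΩ.frontier_eq ▸ hz).2]
  have hmem : MemL2Bdry Ω (0 : Euc d → ℝ) := ⟨0, fun θ _ => ⟨MemLp.zero, by simp⟩⟩
  exact ⟨g, hg, .of_tendsto (fun n => (htr n).1) hg.1 hmem (hg.tendsto_bdryNorm hΩ hb htr hvu)
    (by simp only [hzero]; exact tendsto_const_nhds)⟩

end OmnidirectionalTraces

section ExtensionByZero

variable {d : ℕ} {θ : Euc d} {Ω : Set (Euc d)} {α β : ℝ}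

theorem HasLineTraces.ae_exists_right_eq_zero (hθ : ‖θ‖ = 1) (hΩ : IsOpen Ω)
    (hb : Bornology.IsBounded Ω) {u h : Euc d → ℝ} (hh : HasLineTraces Ω θ u h)
    (h0 : h =ᵐ[dirMeasure Ω θ] 0) :
    ∀ᵐ y : Hyp θ ∂(hypVolume θ), ∀ α β, IsChord Ω θ y α β →
      ∃ f, IsChordRep u θ y α β f ∧ f β = 0 := by
  have hPhi : ∀ᵐ x ∂(volume.restrict Ω), h (Phi Ω θ x) = 0 :=
    ae_of_ae_map (aemeasurable_Phi hΩ hb hθ) h0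
  filter_upwards [hh, ae_chord_of_ae hθ hΩ.measurableSet hPhi] with y hy hyPhi α β hc
  obtain ⟨f, hf, hfβ⟩ := hy α β hc
  have : (ae (volume.restrict (Ioo α β))).NeBot := by
    simpa only [ae_neBot, Ne, Measure.restrict_eq_zero, Real.volume_Ioo, ENNReal.ofReal_eq_zero,
      not_le, sub_pos] using hc.1
  obtain ⟨s, hs, hmem⟩ := ((hyPhi α β hc).and (ae_restrict_mem measurableSet_Ioo)).exists
  exact ⟨f, hf, by rw [← hfβ, ← hc.Phi_eq hθ hb hmem, hs]⟩

theorem ae_restrict_Ioo_neg {P : ℝ → Prop}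
    (h : ∀ᵐ s ∂(volume.restrict (Ioo (-β) (-α))), P s) :
    ∀ᵐ s ∂(volume.restrict (Ioo α β)), P (-s) := by
  rw [ae_restrict_iff' measurableSet_Ioo] at h ⊢
  filter_upwards [(Measure.measurePreserving_neg volume).quasiMeasurePreserving.ae h] with s hs hmem
  exact hs ⟨neg_lt_neg hmem.2, neg_lt_neg hmem.1⟩

theorem HasLineTraces.ae_exists_left_eq_zero (hθ : ‖θ‖ = 1) (hΩ : IsOpen Ω)
    (hb : Bornology.IsBounded Ω) {u h : Euc d → ℝ} (hh : HasLineTraces Ω (-θ) u h)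
    (h0 : h =ᵐ[dirMeasure Ω (-θ)] 0) :
    ∀ᵐ y : Hyp θ ∂(hypVolume θ), ∀ α β, IsChord Ω θ y α β →
      ∃ f, ContinuousOn f (Ico α β) ∧
        (∀ᵐ s ∂(volume.restrict (Ioo α β)), f s = u (line θ y s)) ∧ f α = 0 := by
  have hneg := ae_hyp_neg (P := fun x => ∀ y : Hyp (-θ), (y : Euc d) = x →
    ∀ α β, IsChord Ω (-θ) y α β → ∃ f, IsChordRep u (-θ) y α β f ∧ f β = 0) (θ := θ) <| by
      filter_upwards [hh.ae_exists_right_eq_zero (by rwa [norm_neg]) hΩ hb h0] with y hy y' hyy'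
      rwa [Subtype.ext hyy']
  filter_upwards [hneg] with y hy α β hc
  obtain ⟨f, hf, hfα⟩ := hy ⟨y, by rw [Hyp_neg]; exact y.2⟩ rfl _ _ (hc.neg rfl)
  refine ⟨fun s => f (-s), hf.1.comp continuousOn_neg
    fun s hs => ⟨neg_lt_neg hs.2, neg_le_neg hs.1⟩, ?_, hfα⟩
  filter_upwards [ae_restrict_Ioo_neg hf.2] with s hs
  rw [hs, line, line, neg_smul_neg]

theorem IsGoodLine.integral_mul_deriv_eq_neg {u : H1 Ω} {y : Hyp θ} (h : IsGoodLine u θ y)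
    (hΩ : IsOpen Ω) (hc : IsChord Ω θ y α β)
    (hr : ∃ f, IsChordRep (H1rep u) θ y α β f ∧ f β = 0)
    (hl : ∃ f, ContinuousOn f (Ico α β) ∧
      (∀ᵐ s ∂(volume.restrict (Ioo α β)), f s = H1rep u (line θ y s)) ∧ f α = 0)
    {ψ : ℝ → ℝ} (hψ : AbsolutelyContinuousOnInterval ψ α β) :
    ∫ s in α..β, H1rep u (line θ y s) * deriv ψ s = -∫ s in α..β, lineDerivRep u θ y s * ψ s := by
  obtain ⟨f, hf, hfβ⟩ := hr
  obtain ⟨f', hf', hfu', hfα'⟩ := hl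
  obtain ⟨c, hfc⟩ := h.exists_eqOn_primitive hΩ hc hf
  have hw := h.intervalIntegrable_lineDerivRep hc
  have hcont := (absolutelyContinuousOnInterval_primitive hw c).continuousOn
  rw [uIcc_of_le hc.1.le] at hcont
  have hu : ∀ᵐ s ∂(volume.restrict (Ioo α β)),
      H1rep u (line θ y s) = c + ∫ t in α..s, lineDerivRep u θ y t := by
    filter_upwards [hf.2, ae_restrict_mem measurableSet_Ioo] with s hs hmem
    rw [← hs, hfc (Ioo_subset_Ioc_self hmem)]
  have hfc' : EqOn f' (fun s => c + ∫ t in α..s, lineDerivRep u θ y t) (Ico α β) := by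
    refine Measure.eqOn_Ico_of_ae_eq (μ := volume) ?_ hf' (hcont.mono Ico_subset_Icc_self)
    rw [Measure.restrict_congr_set Ioo_ae_eq_Ico.symm]
    filter_upwards [hfu', hu] with s hs hs' using hs.trans hs'
  have hα : c = 0 := by simpa [hfα'] using (hfc' (left_mem_Ico.2 hc.1)).symm
  have hβ : c + ∫ t in α..β, lineDerivRep u θ y t = 0 := by
    rw [← hfβ, hfc (right_mem_Ioc.2 hc.1)]
  have hparts := integral_primitive_mul_deriv hw c hψ
  rw [hβ, hα, zero_mul, zero_mul, sub_zero, zero_sub] at hparts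
  rw [← hparts, intervalIntegral.integral_of_le hc.1.le, intervalIntegral.integral_of_le hc.1.le,
    ← restrict_Ioo_eq_restrict_Ioc]
  refine integral_congr_ae (hu.mono fun s hs => ?_)
  simp only [hs, hα]

theorem isWeakDirDeriv_univ_indicator {E : Type*} [NormedAddCommGroup E] [NormedSpace ℝ E]
    [MeasureSpace E] {Ω : Set E} (hΩ : MeasurableSet Ω) {v : E} {u w : E → ℝ}
    (h : ∀ φ, IsTestFunction univ φ →
      ∫ x in Ω, u x * fderiv ℝ φ x v = -∫ x in Ω, w x * φ x) :
    IsWeakDirDeriv univ v (Ω.indicator u) (Ω.indicator w) := by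
  intro φ hφ
  simp only [Measure.restrict_univ, ← indicator_mul_left Ω _ (fun x => fderiv ℝ φ x v),
    ← indicator_mul_left Ω _ φ, integral_indicator hΩ]
  exact h φ hφ

theorem isWeakGradient_of_forall_sph {u : Euc d → ℝ} {G : Euc d → Euc d}
    (h : ∀ θ ∈ Sph d, IsWeakDirDeriv Ω θ u fun x => inner ℝ (G x) θ) : IsWeakGradient Ω u G := by
  intro v φ hφ
  rcases eq_or_ne v 0 with rfl | hv
  · simp
  have hθ : ‖v‖⁻¹ • v ∈ Sph d := by
    rw [mem_sphere_zero_iff_norm, norm_smul, norm_inv, norm_norm,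
      inv_mul_cancel₀ (norm_ne_zero_iff.2 hv)]
  have hθφ := h _ hθ φ hφ
  simp only [map_smul, smul_eq_mul, real_inner_smul_right, mul_left_comm _ ‖v‖⁻¹, mul_assoc,
    integral_const_mul, ← mul_neg] at hθφ
  exact mul_left_cancel₀ (inv_ne_zero (norm_ne_zero_iff.2 hv)) hθφ

theorem IsTestFunction.deriv_comp_line {Ω : Set (Euc d)} {φ : Euc d → ℝ} (hφ : IsTestFunction Ω φ)
    (y : Hyp θ) (s : ℝ) : _root_.deriv (φ ∘ line θ y) s = fderiv ℝ φ (line θ y s) θ :=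
  ((hφ.smooth.differentiable (by simp) _).hasFDerivAt.comp_hasDerivAt s
    (hasDerivAt_line θ y s)).deriv

theorem IsTestFunction.absolutelyContinuousOnInterval_comp_line {Ω : Set (Euc d)} {φ : Euc d → ℝ}
    (hφ : IsTestFunction Ω φ) (y : Hyp θ) (α β : ℝ) :
    AbsolutelyContinuousOnInterval (φ ∘ line θ y) α β := by
  have hline : ContDiff ℝ ∞ (line θ y) := by unfold line; fun_prop
  exact ((hφ.smooth.comp hline).of_le (by simp)).contDiffOn.absolutelyContinuousOnInterval

theorem isWeakDirDeriv_univ_of_hasLineTraces (hθ : ‖θ‖ = 1) (hΩ : IsOpen Ω)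
    (hb : Bornology.IsBounded Ω) {u : H1 Ω} {h h' : Euc d → ℝ}
    (hh : HasLineTraces Ω θ (H1rep u) h) (h0 : h =ᵐ[dirMeasure Ω θ] 0)
    (hh' : HasLineTraces Ω (-θ) (H1rep u) h') (h0' : h' =ᵐ[dirMeasure Ω (-θ)] 0) :
    IsWeakDirDeriv univ θ (Ω.indicator (H1rep u))
      (Ω.indicator fun x => inner ℝ (H1grad u x) θ) := by
  have hm := hΩ.measurableSet
  have h2 : (2 : ℝ≥0∞) ≠ ⊤ := ENNReal.ofNat_ne_top
  refine isWeakDirDeriv_univ_indicator hm fun φ hφ => ?_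
  have hφ2 := hφ.memLp.mono_measure (Measure.restrict_mono_set _ (subset_univ Ω))
  have hdφ2 := (hφ.memLp_fderiv θ).mono_measure (Measure.restrict_mono_set _ (subset_univ Ω))
  have hint := (memLp_H1rep u).integrable_mul hdφ2
  have hint' := ((memLp_H1grad u).inner_const θ).integrable_mul hφ2
  rw [← add_eq_zero_iff_eq_neg]
  refine (integral_add hint hint').symm.trans ((integral_lines hθ hm (hint.add hint')).trans
    (integral_eq_zero_of_ae ?_))
  filter_upwards [hh.ae_exists_right_eq_zero hθ hΩ hb h0, hh'.ae_exists_left_eq_zero hθ hΩ hb h0',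
    ae_isGoodLine hθ hΩ hb u, memLp_lines hθ hm two_ne_zero h2 hφ2,
    memLp_lines hθ hm two_ne_zero h2 hdφ2] with y hr hl hgood hφy hdφy
  have hinty := hgood.memLp.integrable_mul hdφy
  have hinty' := hgood.memLp_lineDerivRep.integrable_mul hφy
  refine integral_slice_eq_zero hθ hΩ hb (hinty.add hinty') fun α β hc => ?_
  have hparts := hgood.integral_mul_deriv_eq_neg hΩ hc (hr α β hc) (hl α β hc)
    (hφ.absolutelyContinuousOnInterval_comp_line y α β)
  simp only [hφ.deriv_comp_line, intervalIntegral.integral_of_le hc.1.le,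
    ← restrict_Ioo_eq_restrict_Ioc] at hparts
  exact (integral_add (IntegrableOn.mono_set hinty hc.2.1)
    (IntegrableOn.mono_set hinty' hc.2.1)).trans (add_eq_zero_iff_eq_neg.2 hparts)

theorem isWeakGradient_univ_indicator (hΩ : IsOpen Ω) (hb : Bornology.IsBounded Ω) {u : H1 Ω}
    (hu : u ∈ H1tr0 Ω) :
    IsWeakGradient univ (Ω.indicator (H1rep u)) (Ω.indicator (H1grad u)) := by
  obtain ⟨g, hg, hg0⟩ := hu
  have htrace : ∀ θ ∈ Sph d, ∃ h, HasLineTraces Ω θ (H1rep u) h ∧ h =ᵐ[dirMeasure Ω θ] 0 := by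
    intro θ hθ
    obtain ⟨h, hh, hhg⟩ := hg.2 θ hθ
    exact ⟨h, hh.hasLineTraces (norm_eq_of_mem_sph hθ) hΩ.measurableSet, hhg.trans (hg0 θ hθ)⟩
  refine isWeakGradient_of_forall_sph fun θ hθ => ?_
  obtain ⟨h, hh, h0⟩ := htrace θ hθ
  obtain ⟨h', hh', h0'⟩ := htrace (-θ) (by rwa [mem_sphere_zero_iff_norm, norm_neg,
    ← mem_sphere_zero_iff_norm])
  convert isWeakDirDeriv_univ_of_hasLineTraces (norm_eq_of_mem_sph hθ) hΩ hb hh h0 hh' h0'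
    using 2 with x
  by_cases hx : x ∈ Ω <;> simp [hx]

end ExtensionByZero

section Mollification

theorem eLpNorm_integral_le {X T F : Type*} [MeasurableSpace X] [MeasurableSpace T]
    [NormedAddCommGroup F] [NormedSpace ℝ F] {μ : Measure X} [SFinite μ] {ν : Measure T}
    [IsProbabilityMeasure ν] {f : X → T → F}
    (hf : AEStronglyMeasurable (Function.uncurry f) (μ.prod ν)) {C : ℝ≥0∞}
    (hC : ∀ᵐ t ∂ν, eLpNorm (fun x => f x t) 2 μ ≤ C) :
    eLpNorm (fun x => ∫ t, f x t ∂ν) 2 μ ≤ C := by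
  refine (ENNReal.pow_le_pow_left_iff two_ne_zero).1 ?_
  calc eLpNorm (fun x => ∫ t, f x t ∂ν) 2 μ ^ 2
      = ∫⁻ x, ‖∫ t, f x t ∂ν‖ₑ ^ 2 ∂μ := eLpNorm_two_sq _
    _ ≤ ∫⁻ x, (∫⁻ t, ‖f x t‖ₑ ∂ν) ^ 2 ∂μ :=
        lintegral_mono fun x => pow_le_pow_left' (enorm_integral_le_lintegral_enorm _) 2
    _ ≤ ∫⁻ x, ∫⁻ t, ‖f x t‖ₑ ^ 2 ∂ν ∂μ := by
        refine lintegral_mono_ae (hf.prodMk_left.mono fun x hx => ?_)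
        simpa only [measure_univ, one_mul, Function.uncurry_apply_pair]
          using sq_lintegral_le hx.enorm
    _ = ∫⁻ t, ∫⁻ x, ‖f x t‖ₑ ^ 2 ∂μ ∂ν := lintegral_lintegral_swap (hf.enorm.pow_const 2)
    _ = ∫⁻ t, eLpNorm (fun x => f x t) 2 μ ^ 2 ∂ν := by simp only [eLpNorm_two_sq]
    _ ≤ ∫⁻ _, C ^ 2 ∂ν := lintegral_mono_ae (hC.mono fun t ht => pow_le_pow_left' ht 2)
    _ = C ^ 2 := by rw [lintegral_const, measure_univ, mul_one]

theorem isProbabilityMeasure_withDensity_ofReal {X : Type*} [MeasurableSpace X] {μ : Measure X}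
    {ρ : X → ℝ} (hρ : Integrable ρ μ) (hρ0 : ∀ x, 0 ≤ ρ x) (hρ1 : ∫ x, ρ x ∂μ = 1) :
    IsProbabilityMeasure (μ.withDensity fun x => ENNReal.ofReal (ρ x)) := by
  refine ⟨?_⟩
  rw [withDensity_apply _ MeasurableSet.univ, setLIntegral_univ,
    ← ofReal_integral_eq_lintegral_ofReal hρ (Eventually.of_forall hρ0), hρ1, ENNReal.ofReal_one]

section Translation

variable {E F : Type*} [NormedAddCommGroup E] [NormedSpace ℝ E] [FiniteDimensional ℝ E]
  [MeasureSpace E] [BorelSpace E] [(volume : Measure E).IsAddHaarMeasure] [NormedAddCommGroup F]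
  {h : E → F}

theorem tendsto_eLpNorm_translate_sub (hh : MemLp h 2) :
    Tendsto (fun t : E => eLpNorm (fun x => h (x - t) - h x) 2) (𝓝 0) (𝓝 0) := by
  let T : C(E × E, E) := ⟨fun p => p.2 - p.1, by fun_prop⟩
  have hT : ∀ t : E, MeasurePreserving (T.curry t) := measurePreserving_sub_right volume
  have hcont : Continuous fun t : E => Lp.compMeasurePreserving (T.curry t) (hT t) (hh.toLp h) :=
    continuous_const.compMeasurePreservingLp T.curry.continuous hT ENNReal.ofNat_ne_top
  have hlim := ((hcont.tendsto 0).sub_const (hh.toLp h)).enorm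
  have h0 : Lp.compMeasurePreserving (T.curry 0) (hT 0) (hh.toLp h) = hh.toLp h :=
    Lp.ext ((Lp.coeFn_compMeasurePreserving _ (hT 0)).trans
      (Eventually.of_forall fun x => congrArg (hh.toLp h) (sub_zero x)))
  rw [h0, sub_self, enorm_zero] at hlim
  refine hlim.congr fun t => ?_
  rw [Lp.enorm_def]
  refine eLpNorm_congr_ae ?_
  filter_upwards [Lp.coeFn_sub (Lp.compMeasurePreserving (T.curry t) (hT t) (hh.toLp h))
    (hh.toLp h), Lp.coeFn_compMeasurePreserving (hh.toLp h) (hT t), hh.coeFn_toLp,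
    (hT t).quasiMeasurePreserving.ae hh.coeFn_toLp] with x hsub hcomp hx hTx
  rw [hsub, Pi.sub_apply, hcomp, hx, Function.comp_apply, hTx]
  rfl

theorem aestronglyMeasurable_uncurry_translate (hh : AEStronglyMeasurable h) (ν : Measure E)
    [SFinite ν] :
    AEStronglyMeasurable (fun p : E × E => h (p.1 - p.2)) ((volume : Measure E).prod ν) :=
  hh.comp_quasiMeasurePreserving (quasiMeasurePreserving_sub_of_right_invariant volume ν)

end Translation

open scoped Convolution
open ContinuousLinearMap (lsmul)

variable {E F : Type*} [NormedAddCommGroup E] [NormedSpace ℝ E] [MeasureSpace E] [BorelSpace E]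
  [NormedAddCommGroup F] [NormedSpace ℝ F] {h : E → F} {ρ : E → ℝ}

theorem convolution_eq_integral_withDensity (hρ : IsTestFunction univ ρ) (hρ0 : ∀ t, 0 ≤ ρ t)
    (h : E → F) (x : E) :
    (ρ ⋆[lsmul ℝ ℝ] h) x
      = ∫ t, h (x - t) ∂(volume.withDensity fun t => ENNReal.ofReal (ρ t)) := by
  rw [integral_withDensity_eq_integral_toReal_smul
    hρ.smooth.continuous.measurable.ennreal_ofReal (Eventually.of_forall fun _ => by simp)]
  simp only [ENNReal.toReal_ofReal (hρ0 _), convolution_lsmul]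

variable [FiniteDimensional ℝ E] [(volume : Measure E).IsAddHaarMeasure]

theorem eLpNorm_convolution_le (hρ : IsTestFunction univ ρ) (hρ0 : ∀ t, 0 ≤ ρ t)
    (hρ1 : ∫ t, ρ t = 1) (hh : AEStronglyMeasurable h) :
    eLpNorm (ρ ⋆[lsmul ℝ ℝ] h : E → F) 2 ≤ eLpNorm h 2 := by
  have := isProbabilityMeasure_withDensity_ofReal hρ.integrable hρ0 hρ1
  simp only [funext (convolution_eq_integral_withDensity hρ hρ0 h)]
  exact eLpNorm_integral_le (aestronglyMeasurable_uncurry_translate hh _)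
    (Eventually.of_forall fun t =>
      (eLpNorm_comp_measurePreserving hh (measurePreserving_sub_right volume t)).le)

theorem integrable_smul_translate (hρ : IsTestFunction univ ρ) (hh : Integrable h) (x : E) :
    Integrable fun t => ρ t • h (x - t) :=
  hρ.compact.convolutionExists_left (lsmul ℝ ℝ) hρ.smooth.continuous hh.locallyIntegrable x

theorem continuous_convolution (hρ : IsTestFunction univ ρ) (hh : Integrable h) :
    Continuous (ρ ⋆[lsmul ℝ ℝ] h : E → F) :=
  hρ.compact.continuous_convolution_left _ hρ.smooth.continuous hh.locallyIntegrable

theorem memLp_two_convolution (hρ : IsTestFunction univ ρ) (hρ0 : ∀ t, 0 ≤ ρ t)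
    (hρ1 : ∫ t, ρ t = 1) (hh : Integrable h) (hh2 : MemLp h 2) :
    MemLp (ρ ⋆[lsmul ℝ ℝ] h : E → F) 2 :=
  ⟨(continuous_convolution hρ hh).aestronglyMeasurable,
    (eLpNorm_convolution_le hρ hρ0 hρ1 hh.1).trans_lt hh2.2⟩

theorem eLpNorm_convolution_sub_le [CompleteSpace F] (hρ : IsTestFunction univ ρ)
    (hρ0 : ∀ t, 0 ≤ ρ t) (hρ1 : ∫ t, ρ t = 1) (hh : Integrable h) {ε : ℝ≥0∞}
    (hε : ∀ t, ρ t ≠ 0 → eLpNorm (fun x => h (x - t) - h x) 2 ≤ ε) :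
    eLpNorm (fun x => (ρ ⋆[lsmul ℝ ℝ] h) x - h x) 2 ≤ ε := by
  have := isProbabilityMeasure_withDensity_ofReal hρ.integrable hρ0 hρ1
  have hsub : ∀ x, (ρ ⋆[lsmul ℝ ℝ] h) x - h x
      = ∫ t, (h (x - t) - h x) ∂(volume.withDensity fun t => ENNReal.ofReal (ρ t)) := fun x => by
    rw [convolution_eq_integral_withDensity hρ hρ0, integral_sub ?_ (integrable_const _),
      integral_const, probReal_univ, one_smul]
    refine (integrable_withDensity_iff_integrable_smul'
      hρ.smooth.continuous.measurable.ennreal_ofReal (Eventually.of_forall fun _ => by simp)).2 ?_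
    simpa only [ENNReal.toReal_ofReal (hρ0 _)] using integrable_smul_translate hρ hh x
  simp only [hsub]
  refine eLpNorm_integral_le
    ((aestronglyMeasurable_uncurry_translate hh.1 _).sub hh.1.comp_fst) ?_
  refine (ae_withDensity_iff hρ.smooth.continuous.measurable.ennreal_ofReal).2
    (Eventually.of_forall fun t ht => hε t fun h0 => ht ?_)
  rw [h0, ENNReal.ofReal_zero]

theorem eventually_eLpNorm_convolution_sub_le [CompleteSpace F] (hh : Integrable h)
    (hh2 : MemLp h 2) {ε : ℝ≥0∞} (hε : 0 < ε) :
    ∀ᶠ δ in 𝓝[>] (0 : ℝ), ∀ ρ, IsTestFunction (Metric.ball 0 δ) ρ → (∀ t, 0 ≤ ρ t) →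
      ∫ t, ρ t = 1 → eLpNorm (fun x => (ρ ⋆[lsmul ℝ ℝ] h) x - h x) 2 ≤ ε := by
  obtain ⟨r, hr, hball⟩ := Metric.eventually_nhds_iff_ball.1
    ((tendsto_eLpNorm_translate_sub hh2).eventually (ge_mem_nhds hε))
  filter_upwards [Ioo_mem_nhdsGT hr] with δ hδ ρ hρ hρ0 hρ1
  refine eLpNorm_convolution_sub_le (hρ.mono (subset_univ _)) hρ0 hρ1 hh fun t ht => hball t ?_
  exact Metric.ball_subset_ball hδ.2.le
    (by_contra fun hmem => ht (hρ.eq_zero_of_notMem hmem))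

theorem integral_convolution_mul {u ψ : E → ℝ} (hρ : IsTestFunction univ ρ) (hu : Integrable u)
    (hψ : Continuous ψ) (hψc : HasCompactSupport ψ) :
    ∫ x, (ρ ⋆[lsmul ℝ ℝ] u) x * ψ x = ∫ t, ρ t * ∫ x, u x * ψ (x + t) := by
  obtain ⟨C, hC⟩ := hψc.exists_bound_of_continuous hψ
  have hint : Integrable (fun p : E × E => ρ p.2 * u (p.1 - p.2) * ψ p.1)
      ((volume : Measure E).prod volume) :=
    (hρ.integrable.convolution_integrand (lsmul ℝ ℝ) hu).mul_bdd
      (hψ.comp continuous_fst).aestronglyMeasurable (Eventually.of_forall fun p => hC p.1)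
  calc ∫ x, (ρ ⋆[lsmul ℝ ℝ] u) x * ψ x
      = ∫ x, ∫ t, ρ t * u (x - t) * ψ x := by
        simp only [convolution_lsmul, smul_eq_mul, integral_mul_const]
    _ = ∫ t, ρ t * ∫ x, u (x - t) * ψ x := by
        rw [integral_integral_swap hint]
        simp only [mul_assoc, integral_const_mul]
    _ = ∫ t, ρ t * ∫ x, u x * ψ (x + t) := by
        congr 1 with t
        rw [← integral_add_right_eq_self (fun x => u (x - t) * ψ x) t]
        simp only [add_sub_cancel_right]

theorem IsWeakDirDeriv.convolution {u w : E → ℝ} {v : E} (h : IsWeakDirDeriv univ v u w)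
    (hρ : IsTestFunction univ ρ) (hu : Integrable u) (hw : Integrable w) :
    IsWeakDirDeriv univ v (ρ ⋆[lsmul ℝ ℝ] u) (ρ ⋆[lsmul ℝ ℝ] w) := by
  intro φ hφ
  have hdφ : Continuous fun x => fderiv ℝ φ x v :=
    (hφ.smooth.continuous_fderiv (by simp)).clm_apply continuous_const
  rw [setIntegral_univ, setIntegral_univ,
    integral_convolution_mul hρ hu hdφ (hφ.compact.fderiv_apply ℝ v),
    integral_convolution_mul hρ hw hφ.smooth.continuous hφ.compact, ← integral_neg]
  congr 1 with t
  have ht := h _ (hφ.translate t)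
  simp only [fderiv_comp_add_right, setIntegral_univ] at ht
  rw [ht, mul_neg]

theorem inner_convolution {G : Type*} [NormedAddCommGroup G] [InnerProductSpace ℝ G]
    [CompleteSpace G] {f : E → G} (hρ : IsTestFunction univ ρ) (hf : Integrable f) (x : E) (v : G) :
    inner ℝ ((ρ ⋆[lsmul ℝ ℝ] f) x) v = (ρ ⋆[lsmul ℝ ℝ] fun x => inner ℝ (f x) v) x := by
  rw [convolution_lsmul, convolution_lsmul, real_inner_comm,
    ← integral_inner (integrable_smul_translate hρ hf x)]
  simp only [real_inner_smul_right, smul_eq_mul, real_inner_comm]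

end Mollification

section Approximation

open scoped Convolution
open ContinuousLinearMap (lsmul)

variable {d : ℕ} {Ω : Set (Euc d)} {U : Euc d → ℝ} {G : Euc d → Euc d}

theorem exists_H1_of_isWeakGradient (hU : MemLp U 2 (volume.restrict Ω))
    (hG : MemLp G 2 (volume.restrict Ω)) (h : IsWeakGradient Ω U G) :
    ∃ v : H1 Ω, H1rep v =ᵐ[volume.restrict Ω] U ∧ H1grad v =ᵐ[volume.restrict Ω] G := by
  refine ⟨⟨WithLp.toLp 2 (hU.toLp U, hG.toLp G), fun v φ hφ => ?_⟩, hU.coeFn_toLp, hG.coeFn_toLp⟩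
  refine Eq.trans (integral_congr_ae ?_) ((h v φ hφ).trans (congrArg Neg.neg
    (integral_congr_ae ?_)))
  · filter_upwards [hU.coeFn_toLp] with x hx
    exact congrArg (· * _) hx
  · filter_upwards [hG.coeFn_toLp] with x hx
    exact congrArg (fun z => inner ℝ z v * φ x) hx.symm

theorem enorm_le_eLpNorm_add_eLpNorm (u : H1 Ω) :
    ‖u‖ₑ ≤ eLpNorm (H1rep u) 2 (volume.restrict Ω) + eLpNorm (H1grad u) 2 (volume.restrict Ω) := by
  refine (ENNReal.pow_le_pow_left_iff two_ne_zero).1 ?_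
  rw [enorm_sq_eq, Lp.enorm_def, Lp.enorm_def, add_sq, add_right_comm]
  exact le_self_add

theorem edist_le_of_ae_eq {u v : H1 Ω} {f f' : Euc d → ℝ} {g g' : Euc d → Euc d}
    (hf : H1rep u =ᵐ[volume.restrict Ω] f) (hg : H1grad u =ᵐ[volume.restrict Ω] g)
    (hf' : H1rep v =ᵐ[volume.restrict Ω] f') (hg' : H1grad v =ᵐ[volume.restrict Ω] g') :
    edist u v ≤ eLpNorm (fun x => f x - f' x) 2 (volume.restrict Ω)
      + eLpNorm (fun x => g x - g' x) 2 (volume.restrict Ω) := by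
  rw [edist_eq_enorm_sub]
  refine (enorm_le_eLpNorm_add_eLpNorm _).trans_eq (congrArg₂ _ ?_ ?_)
  · exact eLpNorm_congr_ae ((H1rep_sub u v).trans (hf.sub hf'))
  · exact eLpNorm_congr_ae ((H1grad_sub u v).trans (hg.sub hg'))

theorem IsWeakGradient.mono {Ω' : Set (Euc d)} (h : IsWeakGradient Ω' U G) (hΩ' : IsOpen Ω')
    (hsub : Ω ⊆ Ω') : IsWeakGradient Ω U G :=
  fun v => (h v).mono hΩ' hsub

theorem IsWeakGradient.convolution {ρ : Euc d → ℝ} (h : IsWeakGradient univ U G)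
    (hρ : IsTestFunction univ ρ) (hU : Integrable U) (hG : Integrable G) :
    IsWeakGradient univ (ρ ⋆[lsmul ℝ ℝ] U) (ρ ⋆[lsmul ℝ ℝ] G) := by
  intro v
  simp only [inner_convolution hρ hG]
  exact (h v).convolution hρ hU (hG.inner_const v)

theorem mem_H1tilde_of_isWeakGradient_univ {u : H1 Ω} (hU : Integrable U) (hU2 : MemLp U 2)
    (hG : Integrable G) (hG2 : MemLp G 2) (h : IsWeakGradient univ U G)
    (huU : H1rep u =ᵐ[volume.restrict Ω] U) (huG : H1grad u =ᵐ[volume.restrict Ω] G) :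
    u ∈ H1tilde Ω := by
  refine EMetric.mem_closure_iff.2 fun ε hε => ?_
  obtain ⟨η, hη, hηε⟩ : ∃ η : ℝ≥0∞, 0 < η ∧ η + η < ε := by
    obtain ⟨ε', hε', hlt⟩ := exists_between hε
    exact ⟨ε' / 2, ENNReal.half_pos hε'.ne', by rwa [ENNReal.add_halves]⟩
  obtain ⟨δ, ⟨hUδ, hGδ⟩, hδ⟩ := (((eventually_eLpNorm_convolution_sub_le hU hU2 hη).and
    (eventually_eLpNorm_convolution_sub_le hG hG2 hη)).and self_mem_nhdsWithin).exists
  obtain ⟨ρ, hρ, hρ0, hρ1⟩ := exists_isTestFunction_integral_eq_one (E := Euc d)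
    Metric.isOpen_ball (Metric.nonempty_ball.2 hδ)
  have hρ' := hρ.mono (subset_univ _)
  obtain ⟨v, hvU, hvG⟩ := exists_H1_of_isWeakGradient
    ((memLp_two_convolution hρ' hρ0 hρ1 hU hU2).restrict Ω)
    ((memLp_two_convolution hρ' hρ0 hρ1 hG hG2).restrict Ω)
    ((h.convolution hρ' hU hG).mono isOpen_univ (subset_univ Ω))
  refine ⟨v, ⟨_, (continuous_convolution hρ' hU).continuousOn, hvU⟩, ?_⟩
  rw [edist_comm]
  calc edist v u ≤ _ := edist_le_of_ae_eq hvU hvG huU huG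
    _ ≤ η + η := add_le_add
        ((eLpNorm_mono_measure _ Measure.restrict_le_self).trans (hUδ ρ hρ hρ0 hρ1))
        ((eLpNorm_mono_measure _ Measure.restrict_le_self).trans (hGδ ρ hρ hρ0 hρ1))
    _ < ε := hηε

theorem H1tr0_subset_H1tilde (hΩ : IsOpen Ω) (hb : Bornology.IsBounded Ω) :
    H1tr0 Ω ⊆ H1tilde Ω := by
  intro u hu
  have hm := hΩ.measurableSet
  have : IsFiniteMeasure (volume.restrict Ω) := ⟨by simpa using hb.measure_lt_top⟩
  exact mem_H1tilde_of_isWeakGradient_univ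
    ((integrable_indicator_iff hm).2 ((memLp_H1rep u).integrable one_le_two))
    ((memLp_indicator_iff_restrict hm).2 (memLp_H1rep u))
    ((integrable_indicator_iff hm).2 ((memLp_H1grad u).integrable one_le_two))
    ((memLp_indicator_iff_restrict hm).2 (memLp_H1grad u))
    (isWeakGradient_univ_indicator hΩ hb hu)
    (indicator_ae_eq_restrict hm).symm (indicator_ae_eq_restrict hm).symm

end Approximation

end OmniTrace

end

theorem mainTheorem4 (d : ℕ) (hd : 1 ≤ d) (Ω : Set (EuclideanSpace ℝ (Fin d)))
    (hΩ : IsOpen Ω) (hb : Bornology.IsBounded Ω) :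
    H10 Ω ⊆ H1tr0 Ω ∧ H1tr0 Ω ⊆ H1tilde Ω ∧ H1tilde Ω ⊆ H1tr Ω ∧
    ∀ u ∈ H1tilde Ω, ∃ g : EuclideanSpace ℝ (Fin d) → ℝ, IsOmniTrace u g ∧
      (∀ g', IsOmniTrace u g' → BdryEquiv Ω g' g) ∧
      ∀ (v : ℕ → H1 Ω) (f : ℕ → EuclideanSpace ℝ (Fin d) → ℝ),
        (∀ n, IsContRep (v n) (f n)) → Tendsto v atTop (𝓝 u) →
          Tendsto (fun n => bdryNorm Ω (f n - g)) atTop (𝓝 0) ∧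
          ∀ h, MemL2Bdry Ω h → Tendsto (fun n => bdryNorm Ω (f n - h)) atTop (𝓝 0) →
            BdryEquiv Ω h g := by
  refine ⟨H10_subset_H1tr0 hΩ hb, H1tr0_subset_H1tilde hΩ hb,
    fun u hu => exists_isOmniTrace hΩ hb hu, fun u hu => ?_⟩
  obtain ⟨g, hg⟩ := exists_isOmniTrace hΩ hb hu
  refine ⟨g, hg, fun g' hg' => hg'.bdryEquiv hΩ hb hg, fun v f hf hv => ?_⟩
  have htrace : ∀ n, IsOmniTrace (v n) (f n) := fun n => (hf n).isOmniTrace hΩ hb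
  have hlim := hg.tendsto_bdryNorm hΩ hb htrace hv
  exact ⟨hlim, fun h hh hh' => .of_tendsto (fun n => (htrace n).1) hh hg.1 hh' hlim⟩
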